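/- Consider instances of Stable Marriage with Ties and Incomplete lists (SMTI): finite disjoint sets of women and men, in which each agent finds some of the agents of the other side acceptable and ranks them by a weak order (ties allowed), and every agent prefers each acceptable partner to being unmatched. A matching is a set of pairs (woman, man) that find each other acceptable, in which every agent occurs at most once; it is (weakly) stable if no woman and man, not matched to each other, find each other acceptable and each strictly prefer the other to their current situation. A \emph{typed} instance has $n$ agents partitioned into $k\ge 2$ non-empty types, each type consisting of women only or of men only; each type has a weakly ordered, possibly incomplete preference list over the types of the other side, and every agent's preferences over candidates are those of the agent's type over the candidates' types. The instance is given by the number of types of women and the number of types of men, the number of agents of each type, and the preference lists of the types over types. Then there is an algorithm which, for every typed SMTI instance, computes the size of a maximum stable matching (the largest cardinality of a stable matching; one always exists) in time $k^{\mathcal{O}(k)}\cdot\log^2 n$. Precisely: there are a random access machine and a constant $C$ such that, on every typed SMTI instance with $k \ge 2$ types and $n$ agents, the machine outputs this size in time at most $k^{Ck}\log_2^2 n$, where time is measured by the logarithmic cost criterion (an operation costs the number of bits of the integers that it handles). -/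

import Mathlib

/-! ### Preference lists, SMTI instances, stable matchings -/

/-- A preference list over the candidates `α`, possibly incomplete and possibly with ties: a set of
acceptable candidates, and a total preorder on it. `weak b c` means that `b` is liked at least as
much as `c`; only its values at acceptable candidates matter. -/
structure PrefList (α : Type*) where
  acceptable : α → Prop
  weak : α → α → Prop
  weak_total : ∀ a b, acceptable a → acceptable b → weak a b ∨ weak b a
  weak_trans : ∀ a b c, acceptable a → acceptable b → acceptable c →
    weak a b → weak b c → weak a c

namespace PrefList

/-- `b` and `c` are acceptable and `b` is strictly preferred to `c`. -/
def Prefers {α : Type*} (p : PrefList α) (b c : α) : Prop :=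
  p.acceptable b ∧ p.acceptable c ∧ ¬ p.weak c b

open Classical in
/-- The rank of an acceptable candidate is one plus the number of candidates that are strictly
preferred to it; an unacceptable candidate has rank `0`. -/
noncomputable def rank {α : Type*} (p : PrefList α) (b : α) : ℕ :=
  if p.acceptable b then Set.ncard {c | p.Prefers c b} + 1 else 0

end PrefList

/-- An instance of Stable Marriage with Ties and Incomplete lists, with set of women `W` and set of
men `M`. -/
structure SMTI (W M : Type*) where
  wPref : W → PrefList M
  mPref : M → PrefList W

namespace SMTI

/-- A matching: a set of mutually acceptable pairs in which every agent occurs at most once. -/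
def IsMatching {W M : Type*} (I : SMTI W M) (μ : Finset (W × M)) : Prop :=
  (∀ p ∈ μ, (I.wPref p.1).acceptable p.2 ∧ (I.mPref p.2).acceptable p.1) ∧
  (∀ p ∈ μ, ∀ q ∈ μ, p.1 = q.1 → p = q) ∧
  (∀ p ∈ μ, ∀ q ∈ μ, p.2 = q.2 → p = q)

/-- `(w, m)` blocks `μ`: the pair is not in `μ`, each of the two finds the other acceptable, and
each strictly prefers the other to the current partner, if there is one (being matched to an
acceptable candidate is always preferred to being unmatched). -/
def Blocks {W M : Type*} (I : SMTI W M) (μ : Finset (W × M)) (w : W) (m : M) : Prop :=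
  (w, m) ∉ μ ∧
  ((I.wPref w).acceptable m ∧ ∀ m', (w, m') ∈ μ → (I.wPref w).Prefers m m') ∧
  ((I.mPref m).acceptable w ∧ ∀ w', (w', m) ∈ μ → (I.mPref m).Prefers w w')

/-- A (weakly) stable matching. -/
def IsStable {W M : Type*} (I : SMTI W M) (μ : Finset (W × M)) : Prop :=
  I.IsMatching μ ∧ ∀ w m, ¬ I.Blocks μ w m

end SMTI

/-! ### Typed instances -/

/-- The description of a typed SMTI instance: `k₁` types of women and `k₂` types of men, the
(positive) number of agents of each type, and for each type a preference list over the types of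
candidates. -/
structure TypedSMTI where
  k₁ : ℕ
  k₂ : ℕ
  wSize : Fin k₁ → ℕ
  mSize : Fin k₂ → ℕ
  wSize_pos : ∀ i, 0 < wSize i
  mSize_pos : ∀ j, 0 < mSize j
  wPref : Fin k₁ → PrefList (Fin k₂)
  mPref : Fin k₂ → PrefList (Fin k₁)

namespace TypedSMTI

/-- The number of types. -/
def k (D : TypedSMTI) : ℕ := D.k₁ + D.k₂

/-- The number of agents. -/
def n (D : TypedSMTI) : ℕ := ∑ i, D.wSize i + ∑ j, D.mSize j

/-- The SMTI instance `I` is described by `D`, where `tW` and `tM` give the types of the agents: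
every type has the prescribed number of agents, and the preferences of the agents over candidates
are those of their types over the types of the candidates. -/
structure Describes (D : TypedSMTI) {W M : Type*} (I : SMTI W M)
    (tW : W → Fin D.k₁) (tM : M → Fin D.k₂) : Prop where
  card_w : ∀ i, Nat.card {w // tW w = i} = D.wSize i
  card_m : ∀ j, Nat.card {m // tM m = j} = D.mSize j
  w_acceptable : ∀ w m, (I.wPref w).acceptable m ↔ (D.wPref (tW w)).acceptable (tM m)
  m_acceptable : ∀ m w, (I.mPref m).acceptable w ↔ (D.mPref (tM m)).acceptable (tW w)
  w_weak : ∀ w m m', (I.wPref w).acceptable m → (I.wPref w).acceptable m' →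
    ((I.wPref w).weak m m' ↔ (D.wPref (tW w)).weak (tM m) (tM m'))
  m_weak : ∀ m w w', (I.mPref m).acceptable w → (I.mPref m).acceptable w' →
    ((I.mPref m).weak w w' ↔ (D.mPref (tM m)).weak (tW w) (tW w'))

/-- The input given to the algorithm: the numbers of types of women and of men, the number of
agents of each type, then the table of the ranks of the types of men in the preference lists of the
types of women (row by row), and the table of the ranks of the types of women in the preference
lists of the types of men (row by row). -/
noncomputable def encode (D : TypedSMTI) : List ℕ :=
  [D.k₁, D.k₂] ++ List.ofFn D.wSize ++ List.ofFn D.mSize ++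
    (List.finRange D.k₁).flatMap (fun i => List.ofFn fun j => (D.wPref i).rank j) ++
    (List.finRange D.k₂).flatMap (fun j => List.ofFn fun i => (D.mPref j).rank i)

end TypedSMTI

/-! ### Random access machines with logarithmic cost

The registers `R 0, R 1, …` hold natural numbers. There is a read-only input, a list of natural
numbers. -/

namespace RAM

inductive Instr where
  /-- `R d := c` -/
  | const (d c : ℕ)
  /-- `R d := R a + R b` -/
  | add (d a b : ℕ)
  /-- `R d := R a - R b` (`0` if `R a < R b`) -/
  | sub (d a b : ℕ)
  /-- `R d := R (R a)` -/
  | load (d a : ℕ)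
  /-- `R (R d) := R a` -/
  | store (d a : ℕ)
  /-- `R d :=` the input entry number `R a` (`0` beyond the end of the input) -/
  | read (d a : ℕ)
  /-- go to instruction `l` -/
  | jump (l : ℕ)
  /-- go to instruction `l` if `R a = 0` -/
  | jumpZero (a l : ℕ)

/-- A program is a list of instructions, numbered from `0`. -/
abbrev Program := List Instr

/-- Program counter and contents of the registers. -/
structure Config where
  pc : ℕ
  R : ℕ → ℕ

/-- The configuration after executing one instruction on the input `x`. -/
def exec (x : List ℕ) (s : Config) : Instr → Config
  | .const d c => ⟨s.pc + 1, Function.update s.R d c⟩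
  | .add d a b => ⟨s.pc + 1, Function.update s.R d (s.R a + s.R b)⟩
  | .sub d a b => ⟨s.pc + 1, Function.update s.R d (s.R a - s.R b)⟩
  | .load d a => ⟨s.pc + 1, Function.update s.R d (s.R (s.R a))⟩
  | .store d a => ⟨s.pc + 1, Function.update s.R (s.R d) (s.R a)⟩
  | .read d a => ⟨s.pc + 1, Function.update s.R d (x.getD (s.R a) 0)⟩
  | .jump l => ⟨l, s.R⟩
  | .jumpZero a l => ⟨if s.R a = 0 then l else s.pc + 1, s.R⟩

/-- The logarithmic cost of one instruction: one plus the numbers of binary digits of all register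
addresses, register contents, constants, input positions and input entries that are used. (The
size of a sum or difference is bounded by the sizes of its two operands.) -/
def cost (x : List ℕ) (s : Config) : Instr → ℕ
  | .const d c => 1 + Nat.size d + Nat.size c
  | .add d a b | .sub d a b =>
      1 + Nat.size d + (Nat.size a + Nat.size (s.R a)) + (Nat.size b + Nat.size (s.R b))
  | .load d a => 1 + Nat.size d + Nat.size a + Nat.size (s.R a) + Nat.size (s.R (s.R a))
  | .store d a => 1 + Nat.size d + Nat.size (s.R d) + Nat.size a + Nat.size (s.R a)
  | .read d a => 1 + Nat.size d + Nat.size a + Nat.size (s.R a) + Nat.size (x.getD (s.R a) 0)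
  | .jump _ => 1
  | .jumpZero a _ => 1 + Nat.size a + Nat.size (s.R a)

/-- `Runs P x s s' t`: on the input `x`, the program `P` leads from the configuration `s` to the
configuration `s'`, at the total cost `t`. -/
inductive Runs (P : Program) (x : List ℕ) : Config → Config → ℕ → Prop where
  | refl (s : Config) : Runs P x s s 0
  | step (s s' : Config) (i : Instr) (t : ℕ) (h : P[s.pc]? = some i)
      (hr : Runs P x (exec x s i) s' t) : Runs P x s s' (cost x s i + t)

/-- Started at instruction `0` with all registers `0`, the program `P` on the input `x` halts (by
leaving the program) with the output `y` in register `0`, after time (total cost) `t`. -/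
def HaltsWith (P : Program) (x : List ℕ) (y t : ℕ) : Prop :=
  ∃ s : Config, Runs P x ⟨0, fun _ => 0⟩ s t ∧ P[s.pc]? = none ∧ s.R 0 = y

end RAM

/-! Agents of one type are interchangeable, so the stability of a matching depends only on one
threshold per type: the worst rank of a partner obtained by an agent of that type, or `k + 1` if
some agent of the type is unmatched. A mutually acceptable pair of types produces no blocking pair
exactly when one of the two thresholds is at most the rank of the other type. Conversely, if
thresholds satisfy this for all pairs of types, then every matching that respects them (partners
within the thresholds, agents with threshold at most `k` matched) is stable. Hence it suffices to
try the `(k + 2) ^ k` threshold vectors, coded as numbers in base `k + 2`, and to find for each the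
largest matching that respects it (`exists_code`, `exists_stable`).

For fixed thresholds this is a bipartite matching problem with agents on both sides that must be
covered. Adding dummy agents turns matchings of size `s` that cover them into perfect matchings, so
Hall's theorem gives four inequalities for each set of women (`Covers.hallAt`, `exists_covers`).
Enlarging a set to all women of the types that occur in it only sharpens the inequalities, so the `2
^ k₁` unions of types suffice (`hallAt_top`). The largest size is the number of women minus the
greatest deficiency (`top`). Existence of some stable matching (`exists_rankStable`, by deferred
acceptance) ensures that the maximum over threshold vectors is really attained.

The resulting formula `answer` consists of sums, maxima, truncated differences and zero tests. It is
written in a small expression language whose folds run at most `q` rounds, and the compiler is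
verified once (`code_correct`). With `q = (k + 2) ^ k` the number `N` of steps is polynomial in `q`,
hence `k ^ O(k)` and independent of `n`. Register contents gain at most one bit per step, so the
logarithmic cost is at most of order `N * (log n + N)`, which is even linear in `log n`. -/

/-! ### Numbers of steps of a random access machine, and the logarithmic cost -/

namespace RAM

/-- `StepsN P x s s' n`: on the input `x`, the program `P` leads from `s` to `s'` in `n` steps. -/
inductive StepsN (P : Program) (x : List ℕ) : Config → Config → ℕ → Prop where
  | refl (s : Config) : StepsN P x s s 0
  | step (s s' : Config) (i : Instr) (n : ℕ) (h : P[s.pc]? = some i)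
      (hr : StepsN P x (exec x s i) s' n) : StepsN P x s s' (n + 1)

theorem StepsN.trans {P : Program} {x : List ℕ} {s s' s'' : Config} {m n : ℕ}
    (h₁ : StepsN P x s s' m) (h₂ : StepsN P x s' s'' n) : StepsN P x s s'' (m + n) := by
  induction h₁ with
  | refl s => simpa using h₂
  | step s s' i m h hr ih =>
    have := StepsN.step s s'' i _ h (ih h₂)
    convert this using 1
    omega

theorem StepsN.one {P : Program} {x : List ℕ} {s : Config} (i : Instr) (h : P[s.pc]? = some i) :
    StepsN P x s (exec x s i) 1 :=
  StepsN.step _ _ i 0 h (StepsN.refl _)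

theorem StepsN.cast {P : Program} {x : List ℕ} {s s' : Config} {p n : ℕ}
    (h : StepsN P x s s' n) (hp : s'.pc = p) : StepsN P x s ⟨p, s'.R⟩ n := by
  subst hp
  exact h

/-- All constants and addresses in an instruction have at most `v` binary digits. -/
def Instr.Bdd (v : ℕ) : Instr → Prop
  | .const d c => Nat.size d ≤ v ∧ Nat.size c ≤ v
  | .add d a b | .sub d a b => Nat.size d ≤ v ∧ Nat.size a ≤ v ∧ Nat.size b ≤ v
  | .load d a | .store d a | .read d a => Nat.size d ≤ v ∧ Nat.size a ≤ v
  | .jump _ => True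
  | .jumpZero a _ => Nat.size a ≤ v

theorem Instr.Bdd.mono {v w : ℕ} (h : v ≤ w) {i : Instr} (hi : i.Bdd v) : i.Bdd w := by
  cases i <;> simp only [Instr.Bdd] at hi ⊢ <;> omega

theorem Instr.exists_bdd (i : Instr) : ∃ v, i.Bdd v := by
  cases i with
  | const d c => exact ⟨d.size + c.size, by simp [Instr.Bdd]⟩
  | add d a b => exact ⟨d.size + a.size + b.size, by simp only [Instr.Bdd]; omega⟩
  | sub d a b => exact ⟨d.size + a.size + b.size, by simp only [Instr.Bdd]; omega⟩
  | load d a => exact ⟨d.size + a.size, by simp [Instr.Bdd]⟩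
  | store d a => exact ⟨d.size + a.size, by simp [Instr.Bdd]⟩
  | read d a => exact ⟨d.size + a.size, by simp [Instr.Bdd]⟩
  | jump l => exact ⟨0, trivial⟩
  | jumpZero a l => exact ⟨a.size, le_rfl⟩

theorem Program.exists_bdd (P : Program) : ∃ v, ∀ i ∈ P, i.Bdd v := by
  induction P with
  | nil => exact ⟨0, by simp⟩
  | cons i P ih =>
    obtain ⟨v, hv⟩ := ih
    obtain ⟨w, hw⟩ := i.exists_bdd
    refine ⟨v + w, fun j hj => ?_⟩
    rcases List.mem_cons.1 hj with rfl | hj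
    · exact hw.mono (by omega)
    · exact (hv j hj).mono (by omega)

theorem size_add_le {a b v : ℕ} (ha : Nat.size a ≤ v) (hb : Nat.size b ≤ v) :
    Nat.size (a + b) ≤ v + 1 := by
  rw [Nat.size_le] at *
  rw [pow_succ]
  omega

theorem size_sub_le (a b : ℕ) : Nat.size (a - b) ≤ Nat.size a :=
  Nat.size_le_size (Nat.sub_le _ _)

theorem exec_size_le {x : List ℕ} {v : ℕ} (hx : ∀ a, Nat.size (x.getD a 0) ≤ v) {s : Config}
    (hs : ∀ r, Nat.size (s.R r) ≤ v) {i : Instr} (hi : i.Bdd v) (r : ℕ) :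
    Nat.size ((exec x s i).R r) ≤ v + 1 := by
  have key : ∀ d c, Nat.size c ≤ v + 1 → Nat.size (Function.update s.R d c r) ≤ v + 1 := by
    intro d c hc
    by_cases h : r = d
    · subst h; simpa using hc
    · rw [Function.update_of_ne h]; exact (hs r).trans (Nat.le_succ _)
  cases i with
  | const d c => exact key _ _ (hi.2.trans (Nat.le_succ _))
  | add d a b => exact key _ _ (size_add_le (hs a) (hs b))
  | sub d a b => exact key _ _ ((size_sub_le _ _).trans ((hs a).trans (Nat.le_succ _)))
  | load d a => exact key _ _ ((hs _).trans (Nat.le_succ _))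
  | store d a => exact key _ _ ((hs _).trans (Nat.le_succ _))
  | read d a => exact key _ _ ((hx _).trans (Nat.le_succ _))
  | jump l => exact (hs r).trans (Nat.le_succ _)
  | jumpZero a l => exact (hs r).trans (Nat.le_succ _)

theorem cost_le {x : List ℕ} {v : ℕ} (hx : ∀ a, Nat.size (x.getD a 0) ≤ v) {s : Config}
    (hs : ∀ r, Nat.size (s.R r) ≤ v) {i : Instr} (hi : i.Bdd v) : cost x s i ≤ 1 + 5 * v := by
  cases i with
  | const d c => simp only [cost, Instr.Bdd] at *; omega
  | add d a b => have := hs a; have := hs b; simp only [cost, Instr.Bdd] at *; omega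
  | sub d a b => have := hs a; have := hs b; simp only [cost, Instr.Bdd] at *; omega
  | load d a => have := hs a; have := hs (s.R a); simp only [cost, Instr.Bdd] at *; omega
  | store d a => have := hs a; have := hs d; simp only [cost, Instr.Bdd] at *; omega
  | read d a => have := hs a; have := hx (s.R a); simp only [cost, Instr.Bdd] at *; omega
  | jump l => simp only [cost]; omega
  | jumpZero a l => have := hs a; simp only [cost, Instr.Bdd] at *; omega

/-- The numbers of digits of the register contents grow by at most one in each step, so that the
logarithmic cost is at most quadratic in the number of steps. -/
theorem StepsN.runs {P : Program} {x : List ℕ} {s s' : Config} {n : ℕ} (h : StepsN P x s s' n)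
    (v : ℕ) (hP : ∀ i ∈ P, i.Bdd v) (hx : ∀ a, Nat.size (x.getD a 0) ≤ v)
    (hs : ∀ r, Nat.size (s.R r) ≤ v) :
    ∃ t, Runs P x s s' t ∧ t ≤ n * (1 + 5 * (v + n)) := by
  induction h generalizing v with
  | refl s => exact ⟨0, Runs.refl s, by simp⟩
  | step s s' i n h hr ih =>
    have hi : i ∈ P := List.mem_of_getElem? h
    obtain ⟨t, ht, htn⟩ := ih (v + 1) (fun j hj => (hP j hj).mono (Nat.le_succ v))
      (fun a => (hx a).trans (Nat.le_succ v)) (fun r => exec_size_le hx hs (hP i hi) r)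
    refine ⟨_, Runs.step s s' i t h ht, ?_⟩
    have := cost_le hx hs (hP i hi)
    have e : v + 1 + n = v + (n + 1) := by omega
    rw [e] at htn
    rw [Nat.succ_mul]
    omega

/-! ### Fragments of code inside a program -/

/-- The code `C` stands in the program `P` at position `p`. -/
def CodeAt (P : Program) (p : ℕ) (C : List Instr) : Prop :=
  ∃ pre post, P = pre ++ C ++ post ∧ pre.length = p

theorem CodeAt.left {P : Program} {p : ℕ} {A B : List Instr} (h : CodeAt P p (A ++ B)) :
    CodeAt P p A := by
  obtain ⟨pre, post, rfl, rfl⟩ := h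
  exact ⟨pre, B ++ post, by simp, rfl⟩

theorem CodeAt.right {P : Program} {p : ℕ} {A B : List Instr} (h : CodeAt P p (A ++ B)) :
    CodeAt P (p + A.length) B := by
  obtain ⟨pre, post, rfl, rfl⟩ := h
  exact ⟨pre ++ A, post, by simp, by simp⟩

theorem CodeAt.head {P : Program} {p : ℕ} {i : Instr} {B : List Instr} (h : CodeAt P p (i :: B)) :
    P[p]? = some i := by
  obtain ⟨pre, post, rfl, rfl⟩ := h
  simp

theorem CodeAt.tail {P : Program} {p : ℕ} {i : Instr} {B : List Instr} (h : CodeAt P p (i :: B)) :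
    CodeAt P (p + 1) B :=
  CodeAt.right (A := [i]) h

end RAM

/-! ### An expression language with bounded folds, and its translation into machine code -/

/-- Expressions over an environment, which is a list of natural numbers. -/
inductive Expr where
  | var (j : ℕ)
  | const (c : ℕ)
  | add (a b : Expr)
  | sub (a b : Expr)
  | read (a : Expr)
  | ifz (c a b : Expr)
  | letE (a b : Expr)
  | drop (m : ℕ) (a : Expr)
  | fold (n init g h : Expr)

namespace Expr

/-- The value of an expression on the input `x` in the environment `ρ`; folds are cut off after `q`
rounds. -/
def eval (x : List ℕ) (q : ℕ) : Expr → List ℕ → ℕ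
  | var j, ρ => ρ.getD j 0
  | const c, _ => c
  | add a b, ρ => a.eval x q ρ + b.eval x q ρ
  | sub a b, ρ => a.eval x q ρ - b.eval x q ρ
  | read a, ρ => x.getD (a.eval x q ρ) 0
  | ifz c a b, ρ => if c.eval x q ρ = 0 then a.eval x q ρ else b.eval x q ρ
  | letE a b, ρ => b.eval x q (a.eval x q ρ :: ρ)
  | drop m a, ρ => a.eval x q (ρ.drop m)
  | fold n init g h, ρ => Nat.rec (init.eval x q ρ)
      (fun i acc => h.eval x q [g.eval x q (i :: ρ), acc]) (min (n.eval x q ρ) q)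

/-- The length of the code of an expression. -/
def len : Expr → ℕ
  | var _ => 2
  | const _ => 1
  | add a b => a.len + b.len + 1
  | sub a b => a.len + b.len + 1
  | read a => a.len + 1
  | ifz c a b => c.len + b.len + a.len + 2
  | letE a b => a.len + b.len + 2
  | drop _ a => a.len
  | fold n init g h => init.len + n.len + g.len + h.len + 10

/-- The code of an expression, to be placed at position `p`: the registers `rs` hold the
environment, register `0` the bound on the numbers of rounds of folds, the result is put into
register `t`, and registers below `t` are not changed. -/
def code : Expr → List ℕ → ℕ → ℕ → List RAM.Instr
  | var j, rs, t, _ => [.const t 0, if j < rs.length then .add t (rs.getD j 0) t else .const t 0]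
  | const c, _, t, _ => [.const t c]
  | add a b, rs, t, p => a.code rs t p ++ (b.code rs (t + 1) (p + a.len) ++ [.add t t (t + 1)])
  | sub a b, rs, t, p => a.code rs t p ++ (b.code rs (t + 1) (p + a.len) ++ [.sub t t (t + 1)])
  | read a, rs, t, p => a.code rs t p ++ [.read t t]
  -- The nonzero branch `b` comes first, reached by falling through the conditional jump; it ends
  -- with a jump over `a`.
  | ifz c a b, rs, t, p => c.code rs t p ++
      (.jumpZero t (p + c.len + 1 + b.len + 1) :: (b.code rs t (p + c.len + 1) ++
        (.jump (p + c.len + 1 + b.len + 1 + a.len) :: a.code rs t (p + c.len + 1 + b.len + 1))))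
  | letE a b, rs, t, p => a.code rs t p ++ (b.code (t :: rs) (t + 1) (p + a.len) ++
      [.const t 0, .add t t (t + 1)])
  | drop m a, rs, t, p => a.code (rs.drop m) t p
  -- Register `t` holds the accumulator, `t + 1` the index, `t + 2` the number of remaining rounds,
  -- `t + 3` the value of `g`, `t + 4` that of `h`. The two subtractions form `n - (n - q) = min n
  -- q`, register `0` being `q`.
  | fold n init g h, rs, t, p =>
      init.code rs t p ++ (n.code rs (t + 2) (p + init.len) ++
      (.sub (t + 3) (t + 2) 0 :: .sub (t + 2) (t + 2) (t + 3) :: .const (t + 1) 0 ::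
       .jumpZero (t + 2) (p + init.len + n.len + g.len + h.len + 10) ::
       (g.code ((t + 1) :: rs) (t + 3) (p + init.len + n.len + 4) ++
       (h.code [t + 3, t] (t + 4) (p + init.len + n.len + 4 + g.len) ++
       [.const t 0, .add t t (t + 4), .const (t + 4) 1, .add (t + 1) (t + 1) (t + 4),
        .sub (t + 2) (t + 2) (t + 4), .jump (p + init.len + n.len + 3)]))))

/-- The length depends neither on the registers nor on the position, which is why absolute jump
targets can be computed in advance from `len`. -/
theorem length_code (e : Expr) (rs : List ℕ) (t p : ℕ) : (e.code rs t p).length = e.len := by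
  induction e generalizing rs t p <;> simp [code, len, *] <;> omega

/-- A bound on the number of steps of the code of an expression. -/
def steps (q : ℕ) : Expr → ℕ
  | var _ => 2
  | const _ => 1
  | add a b => a.steps q + b.steps q + 1
  | sub a b => a.steps q + b.steps q + 1
  | read a => a.steps q + 1
  | ifz c a b => c.steps q + b.steps q + a.steps q + 2
  | letE a b => a.steps q + b.steps q + 2
  | drop _ a => a.steps q
  | fold n init g h => init.steps q + n.steps q + q * (g.steps q + h.steps q + 7) + 4

/-- The step bound is built from constants and `q` by sums and products, hence is polynomial in `q`.
The base `q + 2` is at least `2`, so one more factor absorbs a sum of two powers. -/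
theorem exists_steps_le (e : Expr) : ∃ c, ∀ q, e.steps q ≤ (q + 2) ^ c := by
  have hadd : ∀ f g : ℕ → ℕ, (∃ c, ∀ q, f q ≤ (q + 2) ^ c) → (∃ c, ∀ q, g q ≤ (q + 2) ^ c) →
      ∃ c, ∀ q, f q + g q ≤ (q + 2) ^ c := by
    rintro f g ⟨a, ha⟩ ⟨b, hb⟩
    refine ⟨a + b + 1, fun q => ?_⟩
    have h1 : (q + 2) ^ a ≤ (q + 2) ^ (a + b) := Nat.pow_le_pow_right (by omega) (by omega)
    have h2 : (q + 2) ^ b ≤ (q + 2) ^ (a + b) := Nat.pow_le_pow_right (by omega) (by omega)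
    have := ha q
    have := hb q
    rw [pow_succ]
    nlinarith
  have hmul : ∀ f g : ℕ → ℕ, (∃ c, ∀ q, f q ≤ (q + 2) ^ c) → (∃ c, ∀ q, g q ≤ (q + 2) ^ c) →
      ∃ c, ∀ q, f q * g q ≤ (q + 2) ^ c := by
    rintro f g ⟨a, ha⟩ ⟨b, hb⟩
    exact ⟨a + b, fun q => by rw [pow_add]; exact Nat.mul_le_mul (ha q) (hb q)⟩
  have hconst : ∀ m : ℕ, ∃ c, ∀ q : ℕ, m ≤ (q + 2) ^ c := fun m =>
    ⟨m, fun q => (Nat.lt_two_pow_self).le.trans (Nat.pow_le_pow_left (by omega) m)⟩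
  have hid : ∃ c, ∀ q : ℕ, q ≤ (q + 2) ^ c := ⟨1, fun q => by simp⟩
  induction e with
  | var j => exact hconst 2
  | const c => exact hconst 1
  | add a b iha ihb => exact hadd _ _ (hadd _ _ iha ihb) (hconst 1)
  | sub a b iha ihb => exact hadd _ _ (hadd _ _ iha ihb) (hconst 1)
  | read a iha => exact hadd _ _ iha (hconst 1)
  | ifz c a b ihc iha ihb => exact hadd _ _ (hadd _ _ (hadd _ _ ihc ihb) iha) (hconst 2)
  | letE a b iha ihb => exact hadd _ _ (hadd _ _ iha ihb) (hconst 2)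
  | drop m a iha => exact iha
  | fold n init g h ihn ihi ihg ihh =>
    exact hadd _ _ (hadd _ _ (hadd _ _ ihi ihn)
      (hmul _ _ hid (hadd _ _ (hadd _ _ ihg ihh) (hconst 7)))) (hconst 4)

open RAM

theorem map_congr_of_lt {rs : List ℕ} {t : ℕ} (hrs : ∀ r ∈ rs, r < t) {R R' : ℕ → ℕ}
    (h : ∀ r < t, R' r = R r) : rs.map R' = rs.map R :=
  List.map_congr_left fun r hr => h r (hrs r hr)

/-- The code of an expression computes its value. -/
theorem code_correct (P : Program) (x : List ℕ) (e : Expr) :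
    ∀ (rs : List ℕ) (t p : ℕ) (R : ℕ → ℕ), 0 < t → (∀ r ∈ rs, r < t) →
      CodeAt P p (e.code rs t p) →
      ∃ R' n, StepsN P x ⟨p, R⟩ ⟨p + e.len, R'⟩ n ∧ n ≤ e.steps (R 0) ∧ (∀ r < t, R' r = R r) ∧
        R' t = e.eval x (R 0) (rs.map R) := by
  induction e with
  | var j =>
    intro rs t p R ht hrs hC
    by_cases hj : j < rs.length
    · simp only [code, hj, if_true] at hC
      refine ⟨_, _, ((StepsN.one _ hC.head).trans (StepsN.one _ hC.tail.head)).cast rfl, le_rfl,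
        ?_, ?_⟩
      · intro r hr
        simp [exec, Function.update_of_ne hr.ne]
      · have h1 : rs[j] < t := hrs _ (List.getElem_mem hj)
        simp [exec, eval, hj, Function.update_of_ne h1.ne]
    · simp only [code, hj, if_false] at hC
      refine ⟨_, _, ((StepsN.one _ hC.head).trans (StepsN.one _ hC.tail.head)).cast rfl, le_rfl,
        ?_, ?_⟩
      · intro r hr
        simp [exec, Function.update_of_ne hr.ne]
      · simp [exec, eval, hj]
  | const c =>
    intro rs t p R ht hrs hC
    refine ⟨_, _, (StepsN.one _ hC.head).cast rfl, le_rfl, ?_, ?_⟩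
    · intro r hr
      simp [exec, Function.update_of_ne hr.ne]
    · simp [exec, eval]
  | add a b iha ihb =>
    intro rs t p R ht hrs hC
    obtain ⟨R₁, n₁, hs₁, hn₁, hR₁, he₁⟩ := iha rs t p R ht hrs hC.left
    have hC₂ := hC.right
    rw [length_code] at hC₂
    obtain ⟨R₂, n₂, hs₂, hn₂, hR₂, he₂⟩ := ihb rs (t + 1) _ R₁ (by omega)
      (fun r hr => (hrs r hr).trans (by omega)) hC₂.left
    have hC₃ := hC₂.right
    rw [length_code] at hC₃
    rw [hR₁ 0 ht] at hn₂ he₂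
    rw [map_congr_of_lt hrs hR₁] at he₂
    refine ⟨_, _, ((hs₁.trans hs₂).trans (StepsN.one _ hC₃.head)).cast
      (by simp only [exec, len]; omega), ?_, ?_, ?_⟩
    · simp only [steps]; omega
    · intro r hr
      simp [exec, Function.update_of_ne hr.ne, hR₂ r (by omega), hR₁ r hr]
    · simp [exec, eval, he₂, hR₂ t (by omega), he₁]
  | sub a b iha ihb =>
    intro rs t p R ht hrs hC
    obtain ⟨R₁, n₁, hs₁, hn₁, hR₁, he₁⟩ := iha rs t p R ht hrs hC.left
    have hC₂ := hC.right
    rw [length_code] at hC₂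
    obtain ⟨R₂, n₂, hs₂, hn₂, hR₂, he₂⟩ := ihb rs (t + 1) _ R₁ (by omega)
      (fun r hr => (hrs r hr).trans (by omega)) hC₂.left
    have hC₃ := hC₂.right
    rw [length_code] at hC₃
    rw [hR₁ 0 ht] at hn₂ he₂
    rw [map_congr_of_lt hrs hR₁] at he₂
    refine ⟨_, _, ((hs₁.trans hs₂).trans (StepsN.one _ hC₃.head)).cast
      (by simp only [exec, len]; omega), ?_, ?_, ?_⟩
    · simp only [steps]; omega
    · intro r hr
      simp [exec, Function.update_of_ne hr.ne, hR₂ r (by omega), hR₁ r hr]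
    · simp [exec, eval, he₂, hR₂ t (by omega), he₁]
  | read a iha =>
    intro rs t p R ht hrs hC
    obtain ⟨R₁, n₁, hs₁, hn₁, hR₁, he₁⟩ := iha rs t p R ht hrs hC.left
    have hC₂ := hC.right
    rw [length_code] at hC₂
    refine ⟨_, _, (hs₁.trans (StepsN.one _ hC₂.head)).cast
      (by simp only [exec, len]; omega), ?_, ?_, ?_⟩
    · simp only [steps]; omega
    · intro r hr
      simp [exec, Function.update_of_ne hr.ne, hR₁ r hr]
    · simp [exec, eval, he₁]
  | ifz c a b ihc iha ihb =>
    intro rs t p R ht hrs hC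
    obtain ⟨R₁, n₁, hs₁, hn₁, hR₁, he₁⟩ := ihc rs t p R ht hrs hC.left
    have hC₂ := hC.right
    rw [length_code] at hC₂
    have hC₃ := hC₂.tail
    have hC₄ := hC₃.right
    rw [length_code] at hC₄
    have hC₅ := hC₄.tail
    by_cases h0 : c.eval x (R 0) (rs.map R) = 0
    · have hj := StepsN.one (x := x) (s := ⟨p + c.len, R₁⟩) _ hC₂.head
      simp only [exec, he₁, h0, if_true] at hj
      obtain ⟨R₂, n₂, hs₂, hn₂, hR₂, he₂⟩ := iha rs t _ R₁ ht hrs hC₅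
      rw [hR₁ 0 ht, map_congr_of_lt hrs hR₁] at he₂
      rw [hR₁ 0 ht] at hn₂
      refine ⟨R₂, n₁ + 1 + n₂, ?_, ?_, ?_, ?_⟩
      · convert (hs₁.trans hj).trans hs₂ using 2
        simp only [len]; omega
      · simp only [steps]; omega
      · intro r hr; rw [hR₂ r hr, hR₁ r hr]
      · simp [eval, h0, he₂]
    · have hj := StepsN.one (x := x) (s := ⟨p + c.len, R₁⟩) _ hC₂.head
      simp only [exec, he₁, h0, if_false] at hj
      obtain ⟨R₂, n₂, hs₂, hn₂, hR₂, he₂⟩ := ihb rs t _ R₁ ht hrs hC₃.left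
      have hj' := StepsN.one (x := x) (s := ⟨p + c.len + 1 + b.len, R₂⟩) _ hC₄.head
      simp only [exec] at hj'
      rw [hR₁ 0 ht, map_congr_of_lt hrs hR₁] at he₂
      rw [hR₁ 0 ht] at hn₂
      refine ⟨R₂, n₁ + 1 + n₂ + 1, ?_, ?_, ?_, ?_⟩
      · convert ((hs₁.trans hj).trans hs₂).trans hj' using 2
        simp only [len]; omega
      · simp only [steps]; omega
      · intro r hr; rw [hR₂ r hr, hR₁ r hr]
      · simp [eval, h0, he₂]
  | letE a b iha ihb =>
    intro rs t p R ht hrs hC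
    obtain ⟨R₁, n₁, hs₁, hn₁, hR₁, he₁⟩ := iha rs t p R ht hrs hC.left
    have hC₂ := hC.right
    rw [length_code] at hC₂
    obtain ⟨R₂, n₂, hs₂, hn₂, hR₂, he₂⟩ := ihb (t :: rs) (t + 1) _ R₁ (by omega)
      (by simpa using fun r hr => (hrs r hr).trans (Nat.lt_succ_self t)) hC₂.left
    have hC₃ := hC₂.right
    rw [length_code] at hC₃
    rw [hR₁ 0 ht] at hn₂ he₂
    rw [List.map_cons, map_congr_of_lt hrs hR₁, he₁] at he₂
    have hs₃ := (StepsN.one (x := x) (s := ⟨p + a.len + b.len, R₂⟩) _ hC₃.head).trans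
      (StepsN.one _ hC₃.tail.head)
    refine ⟨_, _, ((hs₁.trans hs₂).trans hs₃).cast
      (by simp only [exec, len]; omega), ?_, ?_, ?_⟩
    · simp only [steps]; omega
    · intro r hr
      simp [exec, Function.update_of_ne hr.ne, hR₂ r (by omega), hR₁ r hr]
    · simp [exec, eval, he₂]
  | drop m a iha =>
    intro rs t p R ht hrs hC
    obtain ⟨R₁, n₁, hs₁, hn₁, hR₁, he₁⟩ := iha (rs.drop m) t p R ht
      (fun r hr => hrs r (List.mem_of_mem_drop hr)) hC
    exact ⟨R₁, n₁, hs₁, hn₁, hR₁, by rw [he₁, List.map_drop]; rfl⟩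
  | fold n init g h ihn ihi ihg ihh =>
    intro rs t p R ht hrs hC
    obtain ⟨R₁, n₁, hs₁, hn₁, hR₁, he₁⟩ := ihi rs t p R ht hrs hC.left
    have hC₂ := hC.right
    rw [length_code] at hC₂
    obtain ⟨R₂, n₂, hs₂, hn₂, hR₂, he₂⟩ := ihn rs (t + 2) _ R₁ (by omega)
      (fun r hr => (hrs r hr).trans (by omega)) hC₂.left
    have hC₃ := hC₂.right
    rw [length_code] at hC₃
    rw [hR₁ 0 ht] at hn₂ he₂
    rw [map_congr_of_lt hrs hR₁] at he₂
    have hs₃ := ((StepsN.one (x := x) (s := ⟨p + init.len + n.len, R₂⟩) _ hC₃.head).trans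
      (StepsN.one _ hC₃.tail.head)).trans (StepsN.one _ hC₃.tail.tail.head)
    simp only [exec] at hs₃
    set q := R 0 with hq
    set ρ := rs.map R with hρ
    set L := p + init.len + n.len + 3 with hL
    -- Loop invariant: after `i` rounds, with `m` rounds remaining, the accumulator is the `i`-th
    -- iterate and all registers below `t` are untouched.
    have hloop : ∀ m i (S : ℕ → ℕ), (∀ r < t, S r = R r) → S (t + 1) = i → S (t + 2) = m →
        S t = Nat.rec (init.eval x q ρ) (fun i acc => h.eval x q [g.eval x q (i :: ρ), acc]) i →
        ∃ S' n', StepsN P x ⟨L, S⟩ ⟨p + (fold n init g h).len, S'⟩ n' ∧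
          n' ≤ m * (g.steps q + h.steps q + 7) + 1 ∧ (∀ r < t, S' r = R r) ∧
          S' t = Nat.rec (init.eval x q ρ)
            (fun i acc => h.eval x q [g.eval x q (i :: ρ), acc]) (i + m) := by
      have hC₄ := hC₃.tail.tail.tail
      have hC₅ := hC₄.tail
      have hC₆ := hC₅.right
      rw [length_code] at hC₆
      have hC₇ := hC₆.right
      rw [length_code] at hC₇
      intro m
      induction m with
      | zero =>
        intro i S hS hi hm hacc
        have hj := StepsN.one (x := x) (s := ⟨L, S⟩) _ hC₄.head
        simp only [exec, hm, if_true] at hj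
        refine ⟨S, 1, ?_, by omega, hS, by simpa using hacc⟩
        convert hj using 2
        simp only [len]; omega
      | succ m ih =>
        intro i S hS hi hm hacc
        have hj := StepsN.one (x := x) (s := ⟨L, S⟩) _ hC₄.head
        simp only [exec, hm, Nat.succ_ne_zero, if_false] at hj
        obtain ⟨S₁, m₁, hu₁, hm₁, hS₁, hv₁⟩ := ihg ((t + 1) :: rs) (t + 3) _ S (by omega)
          (by simpa using fun r hr => (hrs r hr).trans (by omega : t < t + 3)) hC₅.left
        obtain ⟨S₂, m₂, hu₂, hm₂, hS₂, hv₂⟩ := ihh [t + 3, t] (t + 4) _ S₁ (by omega)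
          (by simp) hC₆.left
        rw [hS₁ 0 (by omega), hS 0 ht, ← hq] at hv₂ hm₂
        rw [hS 0 ht, ← hq] at hv₁ hm₁
        rw [List.map_cons, map_congr_of_lt hrs hS, hi, ← hρ] at hv₁
        simp only [List.map_cons, List.map_nil, hv₁, hS₁ t (by omega), hacc] at hv₂
        have h1 := hC₇.tail
        have h2 := h1.tail
        have h3 := h2.tail
        have h4 := h3.tail
        have h5 := h4.tail
        have hu₃ := ((((((StepsN.one (x := x) (s := ⟨_, S₂⟩) _ hC₇.head).trans
          (StepsN.one _ h1.head)).trans (StepsN.one _ h2.head)).trans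
          (StepsN.one _ h3.head)).trans (StepsN.one _ h4.head)).trans (StepsN.one _ h5.head))
        simp only [exec] at hu₃
        obtain ⟨S₃, hu₄, h6, h7, h8, h9⟩ : ∃ S₃, StepsN P x ⟨_, S₂⟩ ⟨L, S₃⟩ _ ∧
            (∀ r < t, S₃ r = R r) ∧ S₃ (t + 1) = i + 1 ∧ S₃ (t + 2) = m ∧
            S₃ t = Nat.rec (init.eval x q ρ)
              (fun i acc => h.eval x q [g.eval x q (i :: ρ), acc]) (i + 1) := by
          refine ⟨_, hu₃, ?_, ?_, ?_, ?_⟩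
          · intro r hr
            have a1 : r ≠ t := by omega
            have a2 : r ≠ t + 1 := by omega
            have a3 : r ≠ t + 2 := by omega
            have a4 : r ≠ t + 4 := by omega
            simp [a1, a2, a3, a4, hS₂ r (by omega), hS₁ r (by omega),
              hS r hr]
          · simp [hS₂ (t + 1) (by omega), hS₁ (t + 1) (by omega), hi]
          · simp [hS₂ (t + 2) (by omega), hS₁ (t + 2) (by omega), hm]
          · simp [hv₂]
        obtain ⟨S', n', hS', hn', hR', he'⟩ := ih (i + 1) S₃ h6 h7 h8 h9
        refine ⟨S', _, (((hj.trans hu₁).trans hu₂).trans hu₄).trans hS', ?_, hR', ?_⟩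
        · rw [Nat.succ_mul]; omega
        · rw [he', show i + 1 + m = i + (m + 1) by omega]
    obtain ⟨S₃, hu₄, h6, h7, h8, h9⟩ : ∃ S₃, StepsN P x ⟨_, R₂⟩ ⟨L, S₃⟩ _ ∧
        (∀ r < t, S₃ r = R r) ∧ S₃ (t + 1) = 0 ∧ S₃ (t + 2) = min (n.eval x q ρ) q ∧
        S₃ t = init.eval x q ρ := by
      refine ⟨_, hs₃, ?_, ?_, ?_, ?_⟩
      · intro r hr
        have a1 : r ≠ t + 1 := by omega
        have a2 : r ≠ t + 2 := by omega
        have a3 : r ≠ t + 3 := by omega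
        simp [a1, a2, a3, hR₂ r (by omega), hR₁ r hr]
      · simp
      -- The truncated difference `n - (n - q)` is `min n q`.
      · have a1 : R₂ 0 = q := by rw [hR₂ 0 (by omega), hR₁ 0 ht]
        simp [he₂, a1]
        omega
      · simp [hR₂ t (by omega), he₁]
    obtain ⟨S', n', hS', hn', hR', he'⟩ := hloop (min (n.eval x q ρ) q) 0 S₃ h6 h7 h8 h9
    refine ⟨S', _, ((hs₁.trans hs₂).trans hu₄).trans hS', ?_, hR', ?_⟩
    · simp only [steps]
      have : min (n.eval x q ρ) q * (g.steps q + h.steps q + 7) ≤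
        q * (g.steps q + h.steps q + 7) := Nat.mul_le_mul_right _ (min_le_right _ _)
      omega
    · rw [he']; simp [eval]

end Expr
/-! ### The program made from two expressions -/

namespace Expr

open RAM

/-- The program that computes the bound `q` by means of `e₁`, starting with the bound
`x₀ + x₁ + 2`, and then the value of `e₂`. -/
def program (e₁ e₂ : Expr) : Program :=
  [.read 1 0, .const 2 1, .read 2 2, .add 0 1 2, .const 2 2, .add 0 0 2] ++
    (e₁.code [] 1 6 ++ ([.const 2 0, .add 0 1 2] ++
      (e₂.code [] 1 (6 + e₁.len + 2) ++ [.const 2 0, .add 0 1 2])))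

/-- Two stages: the bound of the first is `k + 2`, read off from the first two input entries; its
result replaces register `0` and bounds the folds of the second. -/
theorem program_steps (e₁ e₂ : Expr) (x : List ℕ) :
    ∃ s n, StepsN (program e₁ e₂) x ⟨0, fun _ => 0⟩ s n ∧ (program e₁ e₂)[s.pc]? = none ∧
      s.R 0 = e₂.eval x (e₁.eval x (x.getD 0 0 + x.getD 1 0 + 2) []) [] ∧
      n ≤ e₁.steps (x.getD 0 0 + x.getD 1 0 + 2) +
        e₂.steps (e₁.eval x (x.getD 0 0 + x.getD 1 0 + 2) []) + 10 := by
  set P := program e₁ e₂ with hP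
  have hC : CodeAt P 0 (program e₁ e₂) := ⟨[], [], by simp [hP], rfl⟩
  have h0 := hC.left
  have h1 := h0.tail
  have h2 := h1.tail
  have h3 := h2.tail
  have h4 := h3.tail
  have h5 := h4.tail
  have hA := hC.right
  have hB := hA.right
  rw [length_code] at hB
  have hD := hB.right
  have hE := hD.right
  rw [length_code] at hE
  have s₁ := (((((StepsN.one (x := x) (s := ⟨0, fun _ => 0⟩) _ h0.head).trans
    (StepsN.one _ h1.head)).trans (StepsN.one _ h2.head)).trans (StepsN.one _ h3.head)).trans
    (StepsN.one _ h4.head)).trans (StepsN.one _ h5.head)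
  set q₀ := x.getD 0 0 + x.getD 1 0 + 2 with hq₀
  obtain ⟨R₁, s₁, hR₁⟩ : ∃ R₁, StepsN P x ⟨0, fun _ => 0⟩ ⟨6, R₁⟩ _ ∧ R₁ 0 = q₀ :=
    ⟨_, s₁, by simp [exec, hq₀]⟩
  obtain ⟨R₂, n₂, s₂, hn₂, -, he₂⟩ := code_correct P x e₁ [] 1 6 R₁ one_pos (by simp) hA.left
  rw [hR₁] at hn₂ he₂
  set q := e₁.eval x q₀ [] with hq
  have s₃ := (StepsN.one (x := x) (s := ⟨6 + e₁.len, R₂⟩) _ hB.head).trans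
    (StepsN.one _ hB.tail.head)
  obtain ⟨R₃, s₃, hR₃⟩ : ∃ R₃, StepsN P x ⟨6 + e₁.len, R₂⟩ ⟨6 + e₁.len + 2, R₃⟩ _ ∧ R₃ 0 = q :=
    ⟨_, s₃, by simp [exec, he₂, hq]⟩
  obtain ⟨R₄, n₄, s₄, hn₄, -, he₄⟩ := code_correct P x e₂ [] 1 _ R₃ one_pos (by simp) hD.left
  rw [hR₃] at hn₄ he₄
  have s₅ := (StepsN.one (x := x) (s := ⟨6 + e₁.len + 2 + e₂.len, R₄⟩) _ hE.head).trans
    (StepsN.one _ hE.tail.head)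
  refine ⟨_, _, (((s₁.trans s₂).trans s₃).trans s₄).trans s₅, ?_, ?_, ?_⟩
  · simp only [exec, List.getElem?_eq_none_iff]
    simp [hP, program, length_code]
    omega
  · simp [exec, he₄]
  · omega

/-- The bound on `N` involves only `k` and `q`; the sizes of the input entries enter the cost
through `v` alone. This separates the dependence on `k` from that on `n`. -/
theorem program_halts (e₁ e₂ : Expr) : ∃ c, ∀ (x : List ℕ) (k q v : ℕ),
    x.getD 0 0 + x.getD 1 0 = k → e₁.eval x (k + 2) [] = q → (∀ a, Nat.size (x.getD a 0) ≤ v) →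
    ∃ t N, HaltsWith (program e₁ e₂) x (e₂.eval x q []) t ∧
      t ≤ N * (1 + 5 * (c + v + N)) ∧ N ≤ (k + 4) ^ c + (q + 2) ^ c + 10 := by
  obtain ⟨w, hw⟩ := (program e₁ e₂).exists_bdd
  obtain ⟨a, ha⟩ := e₁.exists_steps_le
  obtain ⟨b, hb⟩ := e₂.exists_steps_le
  refine ⟨w + a + b, fun x k q v hk hq hv => ?_⟩
  subst hk hq
  obtain ⟨s, n, hs, hpc, hR, hn⟩ := program_steps e₁ e₂ x
  obtain ⟨t, ht, htn⟩ := hs.runs (w + v) (fun i hi => (hw i hi).mono (by omega))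
    (fun a => (hv a).trans (by omega)) (by simp)
  refine ⟨t, n, ⟨s, ht, hpc, hR⟩, htn.trans ?_, hn.trans ?_⟩
  · gcongr
    omega
  · have h1 := (ha (x.getD 0 0 + x.getD 1 0 + 2)).trans
      (Nat.pow_le_pow_right (by omega) (by omega : a ≤ w + a + b))
    have h2 := (hb (e₁.eval x (x.getD 0 0 + x.getD 1 0 + 2) [])).trans
      (Nat.pow_le_pow_right (by omega) (by omega : b ≤ w + a + b))
    rw [show x.getD 0 0 + x.getD 1 0 + 2 + 2 = x.getD 0 0 + x.getD 1 0 + 4 by omega] at h1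
    omega

end Expr

/-! ### The data of types with ranks, and the value computed by the algorithm -/

/-- Numbers of types, sizes of types, and ranks: `rw i j` is the rank of the `j`-th type of men for
the `i`-th type of women, and `rm i j` the rank of the `i`-th type of women for the `j`-th type of
men. -/
structure RankData where
  k₁ : ℕ
  k₂ : ℕ
  ws : ℕ → ℕ
  ms : ℕ → ℕ
  rw : ℕ → ℕ → ℕ
  rm : ℕ → ℕ → ℕ

/-- The digit number `i` of `c` in base `b`. -/
def digit (b i c : ℕ) : ℕ := c / b ^ i % b

namespace RankData

open Finset

variable (D : RankData)

/-- The number of types. -/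
def k : ℕ := D.k₁ + D.k₂

/-- The threshold of a type of women coded by `c`: the worst rank that is allowed for partners. The
value `k + 1` allows agents to be unmatched. -/
def gW (c i : ℕ) : ℕ := digit (D.k + 2) i c

/-- The threshold of a type of men coded by `c`. -/
def gM (c j : ℕ) : ℕ := digit (D.k + 2) (D.k₁ + j) c

/-- `1` if pairs of these types are mutually acceptable and allowed by the thresholds. -/
def edge (c i j : ℕ) : ℕ :=
  if D.rw i j = 0 then 0 else if D.rm i j = 0 then 0 else
    if D.rw i j - D.gW c i = 0 then (if D.rm i j - D.gM c j = 0 then 1 else 0) else 0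

/-- Positive if the type `j` has an allowed partner type in the set coded by `t`. -/
def nbr (c t j : ℕ) : ℕ := ∑ i ∈ range D.k₁, if digit 2 i t = 0 then 0 else D.edge c i j

/-- The number of women with types in the set coded by `t`. -/
def nT (t : ℕ) : ℕ := ∑ i ∈ range D.k₁, if digit 2 i t = 0 then 0 else D.ws i

/-- The number of possible partners of women with types in the set coded by `t`. -/
def nN (c t : ℕ) : ℕ := ∑ j ∈ range D.k₂, if D.nbr c t j = 0 then 0 else D.ms j

/-- The number of men that are possible partners of women with types in the set coded by `t`, or
may be unmatched. -/
def nB (c t : ℕ) : ℕ := ∑ j ∈ range D.k₂,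
  if D.nbr c t j = 0 then (if D.k + 1 - D.gM c j = 0 then D.ms j else 0) else D.ms j

/-- Positive if some type of women in the set coded by `t` may be unmatched. -/
def free (c t : ℕ) : ℕ := ∑ i ∈ range D.k₁,
  if digit 2 i t = 0 then 0 else if D.k + 1 - D.gW c i = 0 then 1 else 0

/-- The number of women. -/
def nW : ℕ := ∑ i ∈ range D.k₁, D.ws i

/-- The number of men. -/
def nM : ℕ := ∑ j ∈ range D.k₂, D.ms j

/-- The largest size of a matching with allowed pairs. -/
def top (c : ℕ) : ℕ := D.nW - (range (2 ^ D.k₁)).sup fun t => D.nT t - D.nN c t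

/-- The violations of stability for the thresholds coded by `c`. -/
def unstable (c : ℕ) : ℕ := ∑ i ∈ range D.k₁, ∑ j ∈ range D.k₂,
  if D.rw i j = 0 then 0 else if D.rm i j = 0 then 0 else
    if D.gW c i - D.rw i j = 0 then 0 else if D.gM c j - D.rm i j = 0 then 0 else 1

/-- The violation of Hall's condition at the set coded by `t`. -/
def hall (c t : ℕ) : ℕ :=
  (if D.free c t = 0 then (D.nT t - D.nN c t) + ((D.nT t + D.nM) - (D.nB c t + D.top c)) else 0) +
    ((D.nT t + D.nM) - (D.nB c t + D.nW))

/-- All violations for the thresholds coded by `c`. -/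
def bad (c : ℕ) : ℕ := D.unstable c + ∑ t ∈ range (2 ^ D.k₁), D.hall c t

/-- The value computed by the algorithm. -/
def answer : ℕ := (range ((D.k + 2) ^ D.k)).sup fun c => if D.bad c = 0 then D.top c else 0

/-- The data read from an input list. -/
def ofInput (x : List ℕ) : RankData where
  k₁ := x.getD 0 0
  k₂ := x.getD 1 0
  ws i := x.getD (i + 2) 0
  ms j := x.getD (j + (2 + x.getD 0 0)) 0
  rw i j := x.getD (i * x.getD 1 0 + j + (2 + (x.getD 0 0 + x.getD 1 0))) 0
  rm i j := x.getD (j * x.getD 0 0 + i +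
    (2 + (x.getD 0 0 + x.getD 1 0) + x.getD 0 0 * x.getD 1 0)) 0

end RankData

/-! ### The expressions for these values -/

namespace Expr

open Finset

/-- The value of `f` at two arguments. -/
def call₂ (f a b : Expr) : Expr := letE b (letE (drop 1 a) f)

/-- The value of `f` at three arguments. -/
def call₃ (f a b c : Expr) : Expr := letE c (letE (drop 1 b) (letE (drop 2 a) f))

/-- The sum of the values of `g` at the numbers below `n`. -/
def sumE (n g : Expr) : Expr := fold n (const 0) g (add (var 1) (var 0))

/-- The maximum of the values of `g` at the numbers below `n`. -/
def supE (n g : Expr) : Expr := fold n (const 0) g (add (var 1) (sub (var 0) (var 1)))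

/-! ### Evaluation of the expressions, and arithmetic by folds -/

section eval

variable (x : List ℕ) (q : ℕ) (ρ : List ℕ)

@[simp] theorem eval_var_zero (a : ℕ) : (var 0).eval x q (a :: ρ) = a := rfl

@[simp] theorem eval_var_succ (a j : ℕ) : (var (j + 1)).eval x q (a :: ρ) = (var j).eval x q ρ := rfl

@[simp] theorem eval_const (c : ℕ) : (const c).eval x q ρ = c := rfl

@[simp] theorem eval_add (a b : Expr) :
    (add a b).eval x q ρ = a.eval x q ρ + b.eval x q ρ := rfl

@[simp] theorem eval_sub (a b : Expr) :
    (sub a b).eval x q ρ = a.eval x q ρ - b.eval x q ρ := rfl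

@[simp] theorem eval_read (a : Expr) : (read a).eval x q ρ = x.getD (a.eval x q ρ) 0 := rfl

@[simp] theorem eval_ifz (c a b : Expr) : (ifz c a b).eval x q ρ =
    if c.eval x q ρ = 0 then a.eval x q ρ else b.eval x q ρ := rfl

@[simp] theorem eval_letE (a b : Expr) :
    (letE a b).eval x q ρ = b.eval x q (a.eval x q ρ :: ρ) := rfl

@[simp] theorem eval_call₂ (f a b : Expr) : (call₂ f a b).eval x q ρ =
    f.eval x q (a.eval x q ρ :: b.eval x q ρ :: ρ) := rfl

@[simp] theorem eval_call₃ (f a b c : Expr) : (call₃ f a b c).eval x q ρ =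
    f.eval x q (a.eval x q ρ :: b.eval x q ρ :: c.eval x q ρ :: ρ) := rfl

theorem eval_sumE (n g : Expr) : (sumE n g).eval x q ρ =
    ∑ i ∈ range (min (n.eval x q ρ) q), g.eval x q (i :: ρ) := by
  simp only [sumE, eval]
  induction min (n.eval x q ρ) q with
  | zero => rfl
  | succ m ih => rw [sum_range_succ, ← ih]; rfl

theorem eval_supE (n g : Expr) : (supE n g).eval x q ρ =
    (range (min (n.eval x q ρ) q)).sup fun i => g.eval x q (i :: ρ) := by
  simp only [supE, eval]
  induction min (n.eval x q ρ) q with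
  | zero => rfl
  | succ m ih =>
    rw [range_add_one, sup_insert, ← ih]
    simp only [List.getD_cons_zero, List.getD_cons_succ]
    -- With truncated subtraction, `acc + (v - acc)` is the maximum of `acc` and `v`.
    simp only [max_def]
    split_ifs <;> omega

/-- Products. -/
def mulE : Expr := sumE (var 0) (var 2)

/-- The first factor is the number of rounds, so it alone is cut off; the second may exceed `q`. -/
theorem eval_mulE (a b : ℕ) : mulE.eval x q (a :: b :: ρ) = min a q * b := by
  simp [mulE, eval_sumE]

/-- Powers. -/
def powE : Expr := fold (var 1) (const 1) (var 1) mulE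

/-- Each multiplication loops over the base and not over the accumulated power, so the result may
exceed `q`. This is what allows `(k + 2) ^ k` to be computed with the bound `k + 2`. -/
theorem eval_powE {b i : ℕ} (hb : b ≤ q) (hi : i ≤ q) : powE.eval x q (b :: i :: ρ) = b ^ i := by
  simp only [powE, eval, eval_mulE, List.getD_cons_zero, List.getD_cons_succ, min_eq_left hi,
    min_eq_left hb]
  clear hi
  induction i with
  | zero => rfl
  | succ i ih => rw [pow_succ, mul_comm, ← ih]

/-- Quotients. -/
def divE : Expr := sumE (var 0)
  (ifz (sub (call₂ mulE (add (var 0) (const 1)) (var 2)) (var 1)) (const 1) (const 0))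

/-- The quotient is found by counting the `i < c` with `(i + 1) * d ≤ c`. Since `i + 1 ≤ c ≤ q`, the
cut-off has no effect. -/
theorem eval_divE {c d : ℕ} (hd : 0 < d) (hc : c ≤ q) :
    divE.eval x q (c :: d :: ρ) = c / d := by
  simp only [divE, eval_sumE, eval_var_zero, min_eq_left hc, eval_ifz, eval_sub, eval_call₂,
    eval_mulE, eval_add, eval_const, eval_var_succ]
  have : ∀ i ∈ range c, (if min (i + 1) q * d - c = 0 then 1 else 0) =
      if i < c / d then 1 else 0 := by
    intro i hi
    rw [mem_range] at hi
    have e : (i + 1) * d - c = 0 ↔ i < c / d := by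
      rw [Nat.sub_eq_zero_iff_le, ← Nat.le_div_iff_mul_le hd]
      exact Iff.rfl
    simp only [min_eq_left (show i + 1 ≤ q by omega), e]
  rw [sum_congr rfl this, sum_boole, Nat.cast_id]
  have h : {i ∈ range c | i < c / d} = range (c / d) := by
    ext i
    have := Nat.div_le_self c d
    simp only [mem_filter, mem_range]
    omega
  rw [h, card_range]

/-- Digits. -/
def digitE : Expr :=
  letE (call₂ divE (var 2) (call₂ powE (var 0) (var 1)))
    (sub (var 0) (call₂ mulE (call₂ divE (var 0) (var 1)) (var 1)))

theorem eval_digitE {b i c : ℕ} (hb : 0 < b) (hbq : b ≤ q) (hi : i ≤ q) (hc : c ≤ q) :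
    digitE.eval x q (b :: i :: c :: ρ) = digit b i c := by
  have h1 : c / b ^ i ≤ q := (Nat.div_le_self _ _).trans hc
  have h2 : c / b ^ i / b ≤ q := (Nat.div_le_self _ _).trans h1
  simp only [digitE, eval_letE, eval_call₂, eval_var_zero, eval_var_succ, eval_sub]
  rw [eval_powE x q _ hbq hi, eval_divE x q _ (by positivity) hc, eval_divE x q _ hb h1,
    eval_mulE, min_eq_left h2, digit, Nat.mod_eq_sub_div_mul]

/-- The number of types of women. -/
def k₁E : Expr := read (const 0)

/-- The number of types of men. -/
def k₂E : Expr := read (const 1)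

/-- The number of types. -/
def kE : Expr := add k₁E k₂E

/-- The sizes of types of women. -/
def wsE : Expr := read (add (var 0) (const 2))

/-- The sizes of types of men. -/
def msE : Expr := read (add (var 0) (add (const 2) k₁E))

/-- The ranks of types of men. -/
def rwE : Expr := read (add (add (call₂ mulE (var 0) k₂E) (var 1)) (add (const 2) kE))

/-- The ranks of types of women. -/
def rmE : Expr := read (add (add (call₂ mulE (var 1) k₁E) (var 0))
  (add (add (const 2) kE) (call₂ mulE k₁E k₂E)))

/-- The thresholds of types of women. -/
def gWE : Expr := call₃ digitE (add kE (const 2)) (var 1) (var 0)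

/-- The thresholds of types of men. -/
def gME : Expr := call₃ digitE (add kE (const 2)) (add k₁E (var 1)) (var 0)

/-- Membership in a set of types of women. -/
def memE : Expr := call₃ digitE (const 2) (var 1) (var 0)

/-- Allowed pairs of types. -/
def edgeE : Expr :=
  ifz (call₂ rwE (var 1) (var 2)) (const 0) (ifz (call₂ rmE (var 1) (var 2)) (const 0)
    (ifz (sub (call₂ rwE (var 1) (var 2)) (call₂ gWE (var 0) (var 1)))
      (ifz (sub (call₂ rmE (var 1) (var 2)) (call₂ gME (var 0) (var 2))) (const 1) (const 0))
      (const 0)))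

/-- Neighbours of a set of types. -/
def nbrE : Expr := sumE k₁E (ifz (call₂ memE (var 2) (var 0)) (const 0)
  (call₃ edgeE (var 1) (var 0) (var 3)))

/-- The number of women with types in a set. -/
def nTE : Expr := sumE k₁E (ifz (call₂ memE (var 1) (var 0)) (const 0) wsE)

/-- The number of possible partners. -/
def nNE : Expr := sumE k₂E (ifz (call₃ nbrE (var 1) (var 2) (var 0)) (const 0) msE)

/-- The number of men that are possible partners or may be unmatched. -/
def nBE : Expr := sumE k₂E (ifz (call₃ nbrE (var 1) (var 2) (var 0))
  (ifz (sub (add kE (const 1)) (call₂ gME (var 1) (var 0))) msE (const 0)) msE)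

/-- The existence of types of women in a set that may be unmatched. -/
def freeE : Expr := sumE k₁E (ifz (call₂ memE (var 2) (var 0)) (const 0)
  (ifz (sub (add kE (const 1)) (call₂ gWE (var 1) (var 0))) (const 1) (const 0)))

/-- The number of women. -/
def nWE : Expr := sumE k₁E wsE

/-- The number of men. -/
def nME : Expr := sumE k₂E msE

/-- The largest size of a matching with allowed pairs. -/
def topE : Expr := sub nWE (supE (call₂ powE (const 2) k₁E)
  (sub nTE (call₂ nNE (var 1) (var 0))))

/-- Violations of stability. -/
def unstableE : Expr := sumE k₁E (sumE k₂E
  (ifz (call₂ rwE (var 1) (var 0)) (const 0) (ifz (call₂ rmE (var 1) (var 0)) (const 0)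
    (ifz (sub (call₂ gWE (var 2) (var 1)) (call₂ rwE (var 1) (var 0))) (const 0)
      (ifz (sub (call₂ gME (var 2) (var 0)) (call₂ rmE (var 1) (var 0))) (const 0) (const 1))))))

/-- Violations of Hall's condition. -/
def hallE : Expr :=
  letE (call₂ nTE (var 1) (var 0)) (letE (call₂ nBE (var 1) (var 2))
    (add (ifz (call₂ freeE (var 2) (var 3))
      (add (sub (var 1) (call₂ nNE (var 2) (var 3)))
        (sub (add (var 1) nME) (add (var 0) (drop 2 topE)))) (const 0))
      (sub (add (var 1) nME) (add (var 0) nWE))))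

/-- All violations. -/
def badE : Expr := add unstableE (sumE (call₂ powE (const 2) k₁E) (call₂ hallE (var 1) (var 0)))

/-- The bound for the folds. -/
def boundE : Expr := call₂ powE (add kE (const 2)) kE

/-- The value computed by the algorithm. -/
def answerE : Expr := supE boundE (ifz badE topE (const 0))

variable {x q}

theorem eval_boundE (hq : (RankData.ofInput x).k + 2 ≤ q) : boundE.eval x q ρ =
    ((RankData.ofInput x).k + 2) ^ (RankData.ofInput x).k := by
  rw [boundE, eval_call₂]
  exact eval_powE x q _ hq (le_trans (Nat.le_add_right _ 2) hq)

end eval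

section eval

open RankData

variable {x : List ℕ} {q : ℕ} (ρ : List ℕ)

theorem eval_k₁E : k₁E.eval x q ρ = (ofInput x).k₁ := rfl

theorem eval_k₂E : k₂E.eval x q ρ = (ofInput x).k₂ := rfl

theorem eval_kE : kE.eval x q ρ = (ofInput x).k := rfl

theorem eval_wsE (i : ℕ) : wsE.eval x q (i :: ρ) = (ofInput x).ws i := rfl

theorem eval_msE (j : ℕ) : msE.eval x q (j :: ρ) = (ofInput x).ms j := rfl

theorem eval_rwE {i j : ℕ} (hi : i ≤ q) : rwE.eval x q (i :: j :: ρ) = (ofInput x).rw i j := by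
  simp only [rwE, eval_read, eval_add, eval_call₂, eval_mulE, eval_var_zero, min_eq_left hi]
  rfl

theorem eval_rmE {i j : ℕ} (hj : j ≤ q) (hk : (ofInput x).k₁ ≤ q) :
    rmE.eval x q (i :: j :: ρ) = (ofInput x).rm i j := by
  simp only [rmE, eval_read, eval_add, eval_call₂, eval_mulE, eval_var_zero, eval_k₁E,
    min_eq_left hk, eval_var_succ, min_eq_left hj]
  rfl

theorem eval_gWE (hq : (ofInput x).k + 2 ≤ q)
    {c i : ℕ} (hc : c ≤ q) (hi : i < (ofInput x).k₁) :
    gWE.eval x q (c :: i :: ρ) = (ofInput x).gW c i := by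
  simp only [gWE, eval_call₃, eval_add, eval_kE, eval_const, eval_var_zero, eval_var_succ]
  rw [eval_digitE x q _ (by omega) hq (by unfold k at hq; omega) hc]
  rfl

theorem eval_gME (hq : (ofInput x).k + 2 ≤ q)
    {c j : ℕ} (hc : c ≤ q) (hj : j < (ofInput x).k₂) :
    gME.eval x q (c :: j :: ρ) = (ofInput x).gM c j := by
  simp only [gME, eval_call₃, eval_add, eval_kE, eval_const, eval_var_zero, eval_var_succ,
    eval_k₁E]
  rw [eval_digitE x q _ (by omega) hq (by unfold k at hq; omega) hc]
  rfl

theorem eval_memE (hq : (ofInput x).k + 2 ≤ q)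
    {t i : ℕ} (ht : t ≤ q) (hi : i < (ofInput x).k₁) :
    memE.eval x q (t :: i :: ρ) = digit 2 i t := by
  simp only [memE, eval_call₃, eval_const, eval_var_zero, eval_var_succ]
  rw [eval_digitE x q _ (by omega) (by omega) (by unfold k at hq; omega) ht]

theorem min_k₁ (hq : (ofInput x).k + 2 ≤ q)
    : min (ofInput x).k₁ q = (ofInput x).k₁ := by unfold k at hq; omega

theorem min_k₂ (hq : (ofInput x).k + 2 ≤ q)
    : min (ofInput x).k₂ q = (ofInput x).k₂ := by unfold k at hq; omega

theorem eval_rw_of_lt (hq : (ofInput x).k + 2 ≤ q)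
    {i j : ℕ} (hi : i < (ofInput x).k₁) :
    rwE.eval x q (i :: j :: ρ) = (ofInput x).rw i j :=
  eval_rwE ρ (by unfold k at hq; omega)

theorem eval_rm_of_lt (hq : (ofInput x).k + 2 ≤ q)
    {i j : ℕ} (hj : j < (ofInput x).k₂) :
    rmE.eval x q (i :: j :: ρ) = (ofInput x).rm i j :=
  eval_rmE ρ (by unfold k at hq; omega) (by unfold k at hq; omega)

theorem eval_edgeE (hq : (ofInput x).k + 2 ≤ q)
    {c i j : ℕ} (hc : c ≤ q) (hi : i < (ofInput x).k₁) (hj : j < (ofInput x).k₂) :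
    edgeE.eval x q (c :: i :: j :: ρ) = (ofInput x).edge c i j := by
  simp only [edgeE, eval_ifz, eval_call₂, eval_sub, eval_var_zero, eval_var_succ, eval_const,
    eval_rw_of_lt _ hq hi, eval_rm_of_lt _ hq hj, eval_gWE _ hq hc hi, eval_gME _ hq hc hj]
  rfl

theorem eval_nbrE (hq : (ofInput x).k + 2 ≤ q)
    {c t j : ℕ} (hc : c ≤ q) (ht : t ≤ q) (hj : j < (ofInput x).k₂) :
    nbrE.eval x q (c :: t :: j :: ρ) = (ofInput x).nbr c t j := by
  rw [nbrE, eval_sumE, eval_k₁E, min_k₁ hq]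
  refine sum_congr rfl fun i hi => ?_
  rw [mem_range] at hi
  simp only [eval_ifz, eval_call₂, eval_call₃, eval_var_zero, eval_var_succ, eval_const,
    eval_memE _ hq ht hi, eval_edgeE _ hq hc hi hj]

theorem eval_nTE (hq : (ofInput x).k + 2 ≤ q)
    {t : ℕ} (ht : t ≤ q) : nTE.eval x q (t :: ρ) = (ofInput x).nT t := by
  rw [nTE, eval_sumE, eval_k₁E, min_k₁ hq]
  refine sum_congr rfl fun i hi => ?_
  rw [mem_range] at hi
  simp only [eval_ifz, eval_call₂, eval_var_zero, eval_var_succ, eval_const,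
    eval_memE _ hq ht hi, eval_wsE]

theorem eval_nNE (hq : (ofInput x).k + 2 ≤ q)
    {c t : ℕ} (hc : c ≤ q) (ht : t ≤ q) :
    nNE.eval x q (c :: t :: ρ) = (ofInput x).nN c t := by
  rw [nNE, eval_sumE, eval_k₂E, min_k₂ hq]
  refine sum_congr rfl fun j hj => ?_
  rw [mem_range] at hj
  simp only [eval_ifz, eval_call₃, eval_var_zero, eval_var_succ, eval_const,
    eval_nbrE _ hq hc ht hj, eval_msE]

theorem eval_nBE (hq : (ofInput x).k + 2 ≤ q)
    {c t : ℕ} (hc : c ≤ q) (ht : t ≤ q) :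
    nBE.eval x q (c :: t :: ρ) = (ofInput x).nB c t := by
  rw [nBE, eval_sumE, eval_k₂E, min_k₂ hq]
  refine sum_congr rfl fun j hj => ?_
  rw [mem_range] at hj
  simp only [eval_ifz, eval_call₃, eval_call₂, eval_var_zero, eval_var_succ, eval_const, eval_sub,
    eval_add, eval_kE, eval_nbrE _ hq hc ht hj, eval_msE, eval_gME _ hq hc hj]

theorem eval_freeE (hq : (ofInput x).k + 2 ≤ q)
    {c t : ℕ} (hc : c ≤ q) (ht : t ≤ q) :
    freeE.eval x q (c :: t :: ρ) = (ofInput x).free c t := by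
  rw [freeE, eval_sumE, eval_k₁E, min_k₁ hq]
  refine sum_congr rfl fun i hi => ?_
  rw [mem_range] at hi
  simp only [eval_ifz, eval_call₂, eval_var_zero, eval_var_succ, eval_const, eval_sub,
    eval_add, eval_kE, eval_memE _ hq ht hi, eval_gWE _ hq hc hi]

theorem eval_nWE (hq : (ofInput x).k + 2 ≤ q)
    : nWE.eval x q ρ = (ofInput x).nW := by
  rw [nWE, eval_sumE, eval_k₁E, min_k₁ hq]
  rfl

theorem eval_nME (hq : (ofInput x).k + 2 ≤ q)
    : nME.eval x q ρ = (ofInput x).nM := by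
  rw [nME, eval_sumE, eval_k₂E, min_k₂ hq]
  rfl

theorem eval_unstableE (hq : (ofInput x).k + 2 ≤ q)
    {c : ℕ} (hc : c ≤ q) :
    unstableE.eval x q (c :: ρ) = (ofInput x).unstable c := by
  rw [unstableE, eval_sumE, eval_k₁E, min_k₁ hq]
  refine sum_congr rfl fun i hi => ?_
  rw [eval_sumE, eval_k₂E, min_k₂ hq]
  refine sum_congr rfl fun j hj => ?_
  rw [mem_range] at hi hj
  simp only [eval_ifz, eval_call₂, eval_var_zero, eval_var_succ, eval_const, eval_sub,
    eval_rw_of_lt _ hq hi, eval_rm_of_lt _ hq hj, eval_gWE _ hq hc hi, eval_gME _ hq hc hj]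

theorem eval_two_powE (hq : (ofInput x).k + 2 ≤ q)
    : (call₂ powE (const 2) k₁E).eval x q ρ = 2 ^ (ofInput x).k₁ := by
  rw [eval_call₂, eval_const, eval_powE x q _ (by omega) (by rw [eval_k₁E]; unfold k at hq; omega)]
  rfl

theorem eval_topE (hq : (ofInput x).k + 2 ≤ q)
    (hq₂ : 2 ^ (ofInput x).k₁ ≤ q)
    {c : ℕ} (hc : c ≤ q) : topE.eval x q (c :: ρ) = (ofInput x).top c := by
  rw [topE, eval_sub, eval_nWE _ hq, eval_supE, eval_two_powE _ hq, min_eq_left hq₂, top]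
  congr 1
  refine sup_congr rfl fun t ht => ?_
  rw [mem_range] at ht
  simp only [eval_sub, eval_call₂, eval_var_zero, eval_var_succ, eval_nTE _ hq (ht.le.trans hq₂),
    eval_nNE _ hq hc (ht.le.trans hq₂)]

theorem eval_hallE (hq : (ofInput x).k + 2 ≤ q)
    (hq₂ : 2 ^ (ofInput x).k₁ ≤ q)
    {c t : ℕ} (hc : c ≤ q) (ht : t ≤ q) :
    hallE.eval x q (c :: t :: ρ) = (ofInput x).hall c t := by
  -- `topE` expects the code `c` at the head of the environment, so the two values bound by `letE`
  -- are dropped.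
  have h : ∀ a b, (drop 2 topE).eval x q (a :: b :: c :: t :: ρ) = (ofInput x).top c :=
    fun a b => eval_topE _ hq hq₂ hc
  simp only [hallE, eval_letE, eval_ifz, eval_call₂, eval_var_zero, eval_var_succ, eval_const,
    eval_sub, eval_add, eval_nTE _ hq ht, eval_nBE _ hq hc ht, eval_nNE _ hq hc ht,
    eval_freeE _ hq hc ht, eval_nWE _ hq, eval_nME _ hq, h]
  rfl

theorem eval_badE (hq : (ofInput x).k + 2 ≤ q)
    (hq₂ : 2 ^ (ofInput x).k₁ ≤ q)
    {c : ℕ} (hc : c ≤ q) : badE.eval x q (c :: ρ) = (ofInput x).bad c := by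
  rw [badE, eval_add, eval_unstableE _ hq hc, eval_sumE, eval_two_powE _ hq, min_eq_left hq₂,
    bad]
  congr 1
  refine sum_congr rfl fun t ht => ?_
  rw [mem_range] at ht
  simp only [eval_call₂, eval_var_zero, eval_var_succ, eval_hallE _ hq hq₂ hc (ht.le.trans hq₂)]

theorem eval_answerE (hq : (ofInput x).k + 2 ≤ q)
    (hq₂ : 2 ^ (ofInput x).k₁ ≤ q)
    (hq₃ : ((ofInput x).k + 2) ^ (ofInput x).k ≤ q) :
    answerE.eval x q ρ = (ofInput x).answer := by
  rw [answerE, eval_supE, eval_boundE _ hq, min_eq_left hq₃, answer]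
  refine sup_congr rfl fun c hc => ?_
  rw [mem_range] at hc
  simp only [eval_ifz, eval_const, eval_badE _ hq hq₂ (hc.le.trans hq₃),
    eval_topE _ hq hq₂ (hc.le.trans hq₃)]

end eval

end Expr
/-! ### Stability in terms of ranks -/

/-- `μ` is a stable matching with respect to ranks; rank `0` means unacceptable. -/
structure RankStable {W M : Type*} (a b : W → M → ℕ) (μ : Finset (W × M)) : Prop where
  pos : ∀ p ∈ μ, 0 < a p.1 p.2 ∧ 0 < b p.1 p.2
  inj_fst : ∀ p ∈ μ, ∀ q ∈ μ, p.1 = q.1 → p = q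
  inj_snd : ∀ p ∈ μ, ∀ q ∈ μ, p.2 = q.2 → p = q
  stable : ∀ w m, 0 < a w m → 0 < b w m →
    (∃ m', (w, m') ∈ μ ∧ a w m' ≤ a w m) ∨ (∃ w', (w', m) ∈ μ ∧ b w' m ≤ b w m)

/-! ### Existence of stable matchings by deferred acceptance -/

section Existence

variable {W M : Type*}

/-- `(w, m)` blocks `μ`, in terms of ranks. -/
def RankBlocks (a b : W → M → ℕ) (μ : Finset (W × M)) (w : W) (m : M) : Prop :=
  0 < a w m ∧ 0 < b w m ∧ (∀ m', (w, m') ∈ μ → a w m < a w m') ∧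
    ∀ w', (w', m) ∈ μ → b w m < b w' m

/-- A matching in which the women of all blocking pairs are unmatched. -/
structure RankSimple (a b : W → M → ℕ) (μ : Finset (W × M)) : Prop where
  pos : ∀ p ∈ μ, 0 < a p.1 p.2 ∧ 0 < b p.1 p.2
  inj_fst : ∀ p ∈ μ, ∀ q ∈ μ, p.1 = q.1 → p = q
  inj_snd : ∀ p ∈ μ, ∀ q ∈ μ, p.2 = q.2 → p = q
  simple : ∀ w m, RankBlocks a b μ w m → ∀ m', (w, m') ∉ μ

open Classical in
/-- Matching an unmatched woman to the best man with whom she blocks keeps a matching simple. -/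
theorem RankSimple.rematch {a b : W → M → ℕ} {μ : Finset (W × M)} (h : RankSimple a b μ) {w : W}
    {m : M} (hb : RankBlocks a b μ w m) (hbest : ∀ m', RankBlocks a b μ w m' → a w m ≤ a w m') :
    RankSimple a b (insert (w, m) (μ.filter fun p => p.2 ≠ m)) := by
  have hs := h.simple w m hb
  have mem : ∀ w' m', (w', m') ∈ insert (w, m) (μ.filter fun p => p.2 ≠ m) ↔
      (w' = w ∧ m' = m) ∨ ((w', m') ∈ μ ∧ m' ≠ m) := by
    intro w' m'
    simp
  refine ⟨?_, ?_, ?_, ?_⟩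
  · rintro ⟨w', m'⟩ hp
    rcases (mem _ _).1 hp with ⟨rfl, rfl⟩ | ⟨hp, -⟩
    · exact ⟨hb.1, hb.2.1⟩
    · exact h.pos _ hp
  · rintro ⟨w₁, m₁⟩ hp ⟨w₂, m₂⟩ hq e
    obtain rfl : w₁ = w₂ := e
    rcases (mem _ _).1 hp with ⟨h1, h2⟩ | ⟨h1, h2⟩ <;> rcases (mem _ _).1 hq with ⟨h3, h4⟩ | ⟨h3, h4⟩
    · rw [h2, h4]
    · subst h1; exact absurd h3 (hs _)
    · subst h3; exact absurd h1 (hs _)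
    · exact h.inj_fst _ h1 _ h3 rfl
  · rintro ⟨w₁, m₁⟩ hp ⟨w₂, m₂⟩ hq e
    obtain rfl : m₁ = m₂ := e
    rcases (mem _ _).1 hp with ⟨h1, h2⟩ | ⟨h1, h2⟩ <;> rcases (mem _ _).1 hq with ⟨h3, h4⟩ | ⟨h3, h4⟩
    · rw [h1, h3]
    · exact absurd h2 h4
    · exact absurd h4 h2
    · exact h.inj_snd _ h1 _ h3 rfl
  · intro u n hu n' hn'
    by_cases huw : u = w
    · subst huw
      have h1 := hu.2.2.1 m ((mem _ _).2 (Or.inl ⟨rfl, rfl⟩))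
      have hnm : n ≠ m := by rintro rfl; exact lt_irrefl _ h1
      -- Men other than `m` gain no new partner. Hence a man whom `w` still prefers and who prefers
      -- her would have blocked with her before, contradicting the choice of `m` as her best.
      have : RankBlocks a b μ u n := ⟨hu.1, hu.2.1, fun x hx => absurd hx (hs x),
        fun x hx => hu.2.2.2 x ((mem _ _).2 (Or.inr ⟨hx, hnm⟩))⟩
      exact absurd (hbest n this) (not_le.2 h1)
    · have hn₁ : (u, n') ∈ μ := by
        rcases (mem _ _).1 hn' with ⟨h1, -⟩ | ⟨h1, -⟩
        · exact absurd h1 huw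
        · exact h1
      have hfst : ∀ x, (u, x) ∈ μ → a u n < a u x := by
        intro x hx
        have : (u, x) = (u, n') := h.inj_fst _ hx _ hn₁ rfl
        rw [this] at hx
        obtain rfl : x = n' := congrArg Prod.snd this
        exact hu.2.2.1 _ hn'
      -- For a woman other than `w` who is matched after the change, the partner is as before, and
      -- no man is worse off than before. So the pair blocked already, although she was matched.
      refine h.simple u n ⟨hu.1, hu.2.1, hfst, fun x hx => ?_⟩ n' hn₁
      by_cases hnm : n = m
      · subst hnm
        exact (hu.2.2.2 w ((mem _ _).2 (Or.inl ⟨rfl, rfl⟩))).trans (hb.2.2.2 x hx)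
      · exact hu.2.2.2 x ((mem _ _).2 (Or.inr ⟨hx, hnm⟩))

open Classical in
/-- Stable matchings exist. -/
theorem exists_rankStable [Finite W] [Finite M] (a b : W → M → ℕ) :
    ∃ μ : Finset (W × M), RankStable a b μ := by
  have := Fintype.ofFinite W
  have := Fintype.ofFinite M
  -- The potential: the pairs whose man already has a partner at least as good as the woman.
  -- Rematching makes it strictly larger, so a simple matching that maximizes its cardinality has no
  -- blocking pair.
  let S : Finset (W × M) → Finset (W × M) := fun μ =>
    Finset.univ.filter fun p => ∃ w', (w', p.2) ∈ μ ∧ b w' p.2 ≤ b p.1 p.2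
  obtain ⟨μ, hμ, hmax⟩ := Finset.exists_max_image
    (Finset.univ.filter fun μ : Finset (W × M) => RankSimple a b μ) (fun μ => (S μ).card)
    ⟨∅, by
      simp only [Finset.mem_filter, Finset.mem_univ, true_and]
      exact ⟨by simp, by simp, by simp, by simp⟩⟩
  simp only [Finset.mem_filter, Finset.mem_univ, true_and] at hμ hmax
  refine ⟨μ, hμ.pos, hμ.inj_fst, hμ.inj_snd, fun w m₀ ha hb => ?_⟩
  by_contra! hcon
  have hb₀ : RankBlocks a b μ w m₀ := ⟨ha, hb, hcon.1, hcon.2⟩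
  obtain ⟨m, hm, hbest⟩ := Finset.exists_min_image
    (Finset.univ.filter fun m => RankBlocks a b μ w m) (fun m => a w m) ⟨m₀, by simpa using hb₀⟩
  simp only [Finset.mem_filter, Finset.mem_univ, true_and] at hm hbest
  have hlt : (S μ).card < (S (insert (w, m) (μ.filter fun p => p.2 ≠ m))).card := by
    refine Finset.card_lt_card (Finset.ssubset_iff_of_subset ?_ |>.2 ⟨(w, m), ?_, ?_⟩)
    · rintro ⟨u, n⟩ hp
      simp only [S, Finset.mem_filter, Finset.mem_univ, true_and] at hp ⊢
      obtain ⟨w', hw', hle⟩ := hp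
      by_cases hn : n = m
      · subst hn
        exact ⟨w, by simp, (hm.2.2.2 w' hw').le.trans hle⟩
      · exact ⟨w', by simp [hw', hn], hle⟩
    · simp only [S, Finset.mem_filter, Finset.mem_univ, true_and]
      exact ⟨w, by simp, le_rfl⟩
    · simp only [S, Finset.mem_filter, Finset.mem_univ, true_and, not_exists, not_and, not_le]
      exact hm.2.2.2
  exact absurd (hmax _ (hμ.rematch hm hbest)) (not_le.2 hlt)

end Existence

/-! ### Matchings that cover prescribed agents -/

open Classical in
/-- The number of elements with the property `p`. -/
noncomputable def cnt {α : Type*} [Fintype α] (p : α → Prop) : ℕ :=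
  (Finset.univ.filter p).card

theorem le_cnt {α : Type*} [Fintype α] {p : α → Prop} {s : Finset α} (h : ∀ a ∈ s, p a) :
    s.card ≤ cnt p :=
  Finset.card_le_card fun a ha => by simpa using h a ha

theorem cnt_le {α : Type*} [Fintype α] {p : α → Prop} {s : Finset α} (h : ∀ a, p a → a ∈ s) :
    cnt p ≤ s.card :=
  Finset.card_le_card fun a ha => h a (by simpa using ha)

section Covering

open Finset Classical

variable {W M : Type*} [Fintype W] [Fintype M]

/-- The matching `μ` consists of pairs in `E` and covers `A` and `B`. -/
structure Covers (E : W → M → Prop) (A : W → Prop) (B : M → Prop) (μ : Finset (W × M)) : Prop where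
  rel : ∀ p ∈ μ, E p.1 p.2
  inj_fst : ∀ p ∈ μ, ∀ q ∈ μ, p.1 = q.1 → p = q
  inj_snd : ∀ p ∈ μ, ∀ q ∈ μ, p.2 = q.2 → p = q
  fst : ∀ w, A w → ∃ m, (w, m) ∈ μ
  snd : ∀ m, B m → ∃ w, (w, m) ∈ μ

/-- Hall's conditions for matchings of size `s` with pairs in `E` that cover `A` and `B`, at the set
`S` of women. -/
structure HallAt (E : W → M → Prop) (A : W → Prop) (B : M → Prop) (s : ℕ) (S : Finset W) :
    Prop where
  must : (∀ w ∈ S, A w) → #S ≤ cnt fun m => ∃ w ∈ S, E w m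
  all : #S + s ≤ Fintype.card W + cnt fun m => ∃ w ∈ S, E w m
  must_compl : (∀ w ∈ S, A w) → #S + Fintype.card M ≤ (cnt fun m => (∃ w ∈ S, E w m) ∨ ¬ B m) + s
  compl : #S + Fintype.card M ≤ (cnt fun m => (∃ w ∈ S, E w m) ∨ ¬ B m) + Fintype.card W

/-- Let `ν` be the part of `μ` at `S`. Its men are neighbours of `S`, and the `|M| - #μ` unmatched
men lie outside `B` and are disjoint from them. On the other side, `S` consists of women of `ν` and
of some of the `|W| - #μ` unmatched women, and of women of `ν` only if `S` lies in `A`. Each of the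
four inequalities combines one estimate for the men with one for the women. -/
theorem Covers.hallAt {E : W → M → Prop} {A : W → Prop} {B : M → Prop} {μ : Finset (W × M)}
    (h : Covers E A B μ) (S : Finset W) : HallAt E A B #μ S := by
  set ν := μ.filter fun p => p.1 ∈ S with hν
  have hνμ : ∀ p ∈ ν, p ∈ μ := fun p hp => (mem_filter.1 hp).1
  have c1 : #(ν.image Prod.fst) = #ν := card_image_of_injOn fun p hp q hq e =>
    h.inj_fst p (hνμ p hp) q (hνμ q hq) e
  have c2 : #(ν.image Prod.snd) = #ν := card_image_of_injOn fun p hp q hq e =>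
    h.inj_snd p (hνμ p hp) q (hνμ q hq) e
  have c3 : #(μ.image Prod.fst) = #μ := card_image_of_injOn fun p hp q hq e =>
    h.inj_fst p hp q hq e
  have c4 : #(μ.image Prod.snd) = #μ := card_image_of_injOn fun p hp q hq e =>
    h.inj_snd p hp q hq e
  have c5 := card_add_card_compl (μ.image Prod.fst)
  have c6 := card_add_card_compl (μ.image Prod.snd)
  have n1 : ∀ m ∈ ν.image Prod.snd, ∃ w ∈ S, E w m := by
    intro m hm
    obtain ⟨p, hp, rfl⟩ := mem_image.1 hm
    exact ⟨p.1, (mem_filter.1 hp).2, h.rel p (hνμ p hp)⟩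
  have n2 : ∀ m ∈ ν.image Prod.snd ∪ (μ.image Prod.snd)ᶜ, (∃ w ∈ S, E w m) ∨ ¬ B m := by
    intro m hm
    rcases mem_union.1 hm with hm | hm
    · exact Or.inl (n1 m hm)
    · right
      intro hB
      obtain ⟨w, hw⟩ := h.snd m hB
      exact mem_compl.1 hm (mem_image_of_mem Prod.snd hw)
  have n3 : Disjoint (ν.image Prod.snd) (μ.image Prod.snd)ᶜ := by
    refine disjoint_compl_right.mono_left ?_
    exact image_subset_image (filter_subset _ _)
  have n4 : S ⊆ ν.image Prod.fst ∪ (μ.image Prod.fst)ᶜ := by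
    intro w hw
    by_cases hm : w ∈ μ.image Prod.fst
    · obtain ⟨p, hp, rfl⟩ := mem_image.1 hm
      exact mem_union_left _ (mem_image_of_mem _ (mem_filter.2 ⟨hp, hw⟩))
    · exact mem_union_right _ (mem_compl.2 hm)
  have n5 : (∀ w ∈ S, A w) → S ⊆ ν.image Prod.fst := by
    intro hA w hw
    obtain ⟨m, hm⟩ := h.fst w (hA w hw)
    exact mem_image.2 ⟨(w, m), mem_filter.2 ⟨hm, hw⟩, rfl⟩
  have d1 := le_cnt n1
  have d2 := le_cnt n2
  rw [card_union_of_disjoint n3] at d2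
  have d4 := (card_le_card n4).trans (card_union_le _ _)
  refine ⟨fun hA => ?_, ?_, fun hA => ?_, ?_⟩
  · have := card_le_card (n5 hA); omega
  · omega
  · have := card_le_card (n5 hA); omega
  · omega

/-- If Hall's conditions hold, then there is a covering matching of size `s`. -/
theorem exists_covers {E : W → M → Prop} {A : W → Prop} {B : M → Prop} {s : ℕ}
    (h : ∀ S, HallAt E A B s S) : ∃ μ, Covers E A B μ ∧ #μ = s := by
  have hsW : s ≤ Fintype.card W := by simpa [cnt] using (h ∅).all
  have hsM : s ≤ Fintype.card M := by
    have := (h univ).all.trans (Nat.add_le_add_left (cnt_le (s := univ) (by simp)) _)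
    rw [card_univ, card_univ] at this
    omega
  -- Dummy women may take exactly the men outside `B`, dummy men exactly the women outside `A`, and
  -- dummies are never joined to each other. A perfect matching then leaves `|W| - s` women and `|M|
  -- - s` men to dummies, so `s` real pairs remain.
  let r : W ⊕ Fin (Fintype.card M - s) → M ⊕ Fin (Fintype.card W - s) → Prop :=
    Sum.elim (fun w => Sum.elim (E w) fun _ => ¬ A w) fun _ => Sum.elim (fun m => ¬ B m)
      fun _ => False
  have hall : ∀ S : Finset (W ⊕ Fin (Fintype.card M - s)), #S ≤ #{y | ∃ x ∈ S, r x y} := by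
    intro S
    obtain ⟨h1, h2, h3, h4⟩ := h S.toLeft
    rw [← card_toLeft_add_card_toRight (u := S),
      ← card_toLeft_add_card_toRight (u := ({y | ∃ x ∈ S, r x y} : Finset _))]
    set U : Finset (M ⊕ Fin (Fintype.card W - s)) := {y | ∃ x ∈ S, r x y} with hU
    have l1 : ∀ m, (∃ w ∈ S.toLeft, E w m) → m ∈ U.toLeft := by
      intro m hm
      simp only [mem_filter, mem_univ, true_and, mem_toLeft, hU] at hm ⊢
      obtain ⟨w, hw, hE⟩ := hm
      exact ⟨_, hw, hE⟩
    have l2 : S.toRight.Nonempty →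
        ∀ m, (∃ w ∈ S.toLeft, E w m) ∨ ¬ B m → m ∈ U.toLeft := by
      rintro ⟨d, hd⟩ m hm
      rw [mem_toRight] at hd
      simp only [mem_filter, mem_univ, true_and, mem_toLeft, hU] at hm ⊢
      rcases hm with ⟨w, hw, hE⟩ | hB
      · exact ⟨_, hw, hE⟩
      · exact ⟨_, hd, hB⟩
    have l3 : ¬ (∀ w ∈ S.toLeft, A w) → #U.toRight = Fintype.card W - s := by
      intro hA
      push Not at hA
      obtain ⟨w, hw, hA⟩ := hA
      have : U.toRight = univ := by
        ext d
        simp only [mem_filter, mem_univ, true_and, mem_toRight, hU, iff_true]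
        exact ⟨_, mem_toLeft.1 hw, hA⟩
      rw [this, card_univ, Fintype.card_fin]
    have l4 : #S.toRight ≤ Fintype.card M - s := by
      simpa using card_le_univ S.toRight
    have l5 := cnt_le l1
    -- The four inequalities correspond to the four cases: whether the real women of `S` all lie in
    -- `A` (otherwise all dummy men are neighbours), and whether `S` contains a dummy woman (if so,
    -- all men outside `B` are neighbours).
    by_cases hA : ∀ w ∈ S.toLeft, A w
    · have h1 := h1 hA
      have h3 := h3 hA
      rcases S.toRight.eq_empty_or_nonempty with h0 | h0
      · rw [h0, card_empty]; omega
      · have := cnt_le (l2 h0); omega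
    · have := l3 hA
      rcases S.toRight.eq_empty_or_nonempty with h0 | h0
      · rw [h0, card_empty]; omega
      · have := cnt_le (l2 h0); omega
  obtain ⟨f, hf, hr⟩ := (Fintype.all_card_le_filter_rel_iff_exists_injective r).1 hall
  -- Both sides have `|W| + |M| - s` elements, as `s ≤ |W|` and `s ≤ |M|`, so the injection is a
  -- perfect matching.
  have hbij : Function.Bijective f := by
    rw [Fintype.bijective_iff_injective_and_card]
    refine ⟨hf, ?_⟩
    simp only [Fintype.card_sum, Fintype.card_fin]
    omega
  have hdummy : ∀ d, ∃ w, f (Sum.inl w) = Sum.inr d := by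
    intro d
    obtain ⟨x | d', hx⟩ := hbij.2 (Sum.inr d)
    · exact ⟨x, hx⟩
    · have := hr (Sum.inr d')
      rw [hx] at this
      exact this.elim
  choose g hg using hdummy
  have hginj : Function.Injective g := by
    intro d d' e
    have := hg d
    rw [e, hg d'] at this
    exact (Sum.inr.inj this).symm
  set μ : Finset (W × M) := {p | f (Sum.inl p.1) = Sum.inl p.2} with hμ
  have mem : ∀ p, p ∈ μ ↔ f (Sum.inl p.1) = Sum.inl p.2 := by simp [hμ]
  have inj : ∀ p ∈ μ, ∀ q ∈ μ, p.1 = q.1 → p = q := by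
    intro p hp q hq e
    rw [mem] at hp hq
    rw [e, hq] at hp
    exact Prod.ext e (Sum.inl.inj hp).symm
  refine ⟨μ, ⟨?_, inj, ?_, ?_, ?_⟩, ?_⟩
  · intro p hp
    rw [mem] at hp
    have := hr (Sum.inl p.1)
    rw [hp] at this
    exact this
  · intro p hp q hq e
    rw [mem] at hp hq
    rw [e, ← hq] at hp
    exact Prod.ext (Sum.inl.inj (hf hp)) e
  · intro w hA
    rcases hx : f (Sum.inl w) with m | d
    · exact ⟨m, (mem _).2 hx⟩
    · have := hr (Sum.inl w)
      rw [hx] at this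
      exact absurd hA this
  · intro m hB
    obtain ⟨w | d, hx⟩ := hbij.2 (Sum.inl m)
    · exact ⟨w, (mem _).2 hx⟩
    · have := hr (Sum.inr d)
      rw [hx] at this
      exact absurd hB this
  · have e1 : #(μ.image Prod.fst) = #μ := card_image_of_injOn fun p hp q hq e => inj p hp q hq e
    -- The women not covered by `μ` are the partners of the dummy men, hence `|W| - s` in number.
    have e2 : (μ.image Prod.fst)ᶜ = univ.image g := by
      ext w
      simp only [mem_compl, mem_image, mem_univ, true_and, not_exists, not_and]
      constructor
      · intro hw
        rcases hx : f (Sum.inl w) with m | d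
        · exact absurd rfl (hw (w, m) ((mem _).2 hx))
        · exact ⟨d, Sum.inl.inj (hf ((hg d).trans hx.symm))⟩
      · rintro ⟨d, rfl⟩ p hp e
        rw [mem, e, hg d] at hp
        exact absurd hp (by simp)
    have e3 := card_add_card_compl (μ.image Prod.fst)
    rw [e2, card_image_of_injective _ hginj, card_univ, Fintype.card_fin, e1] at e3
    omega

end Covering

/-- All sequences of digits occur. -/
theorem exists_digit (b k : ℕ) (G : ℕ → ℕ) (hG : ∀ i < k, G i < b) :
    ∃ c < b ^ k, ∀ i < k, digit b i c = G i := by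
  induction k generalizing G with
  | zero => exact ⟨0, by simp, by simp⟩
  | succ k ih =>
    obtain ⟨c, hc, hd⟩ := ih (fun i => G (i + 1)) fun i hi => hG (i + 1) (by omega)
    have h0 := hG 0 (by omega)
    refine ⟨G 0 + b * c, ?_, ?_⟩
    · have : b * (c + 1) ≤ b * b ^ k := Nat.mul_le_mul_left b hc
      rw [pow_succ']
      rw [Nat.mul_succ] at this
      omega
    · rintro (_ | i) hi
      · simp [digit, Nat.mod_eq_of_lt h0]
      · rw [← hd i (by omega), digit, digit, pow_succ', ← Nat.div_div_eq_div_mul,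
          Nat.add_mul_div_left _ _ (by omega), Nat.div_eq_of_lt h0, zero_add]
/-! ### The value computed by the algorithm, and stable matchings -/

namespace RankData

open Finset Classical

variable {W M : Type*} [Fintype W] [Fintype M]

/-- The agents in `W` and `M` with types `tW` and `tM` are described by the data `R`. -/
structure Realizes (R : RankData) (tW : W → ℕ) (tM : M → ℕ) : Prop where
  tW_lt : ∀ w, tW w < R.k₁
  tM_lt : ∀ m, tM m < R.k₂
  card_w : ∀ i < R.k₁, (cnt fun w => tW w = i) = R.ws i
  card_m : ∀ j < R.k₂, (cnt fun m => tM m = j) = R.ms j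
  exists_w : ∀ i < R.k₁, ∃ w, tW w = i
  exists_m : ∀ j < R.k₂, ∃ m, tM m = j
  rw_le : ∀ i < R.k₁, ∀ j < R.k₂, R.rw i j ≤ R.k
  rm_le : ∀ i < R.k₁, ∀ j < R.k₂, R.rm i j ≤ R.k

/-- Partition of the agents into the fibres of `t`. It translates the sums over types in the
algorithm into numbers of agents. -/
theorem sum_sizes {t : W → ℕ} {k : ℕ} {s : ℕ → ℕ} (ht : ∀ w, t w < k)
    (hs : ∀ i < k, (cnt fun w => t w = i) = s i) (p : ℕ → Prop) :
    ∑ i ∈ range k, (if p i then s i else 0) = cnt fun w => p (t w) := by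
  unfold cnt at hs ⊢
  rw [card_eq_sum_card_fiberwise (f := t) (t := range k) (fun w _ => by simpa using ht w)]
  refine sum_congr rfl fun i hi => ?_
  rw [filter_filter]
  split_ifs with h
  · rw [← hs i (mem_range.1 hi)]
    congr 1
    ext w
    simp only [mem_filter, mem_univ, true_and]
    exact ⟨fun e => ⟨e ▸ h, e⟩, fun e => e.2⟩
  · symm
    rw [card_eq_zero, filter_eq_empty_iff]
    rintro w - ⟨h1, rfl⟩
    exact h h1

/-- The agents with types in the set coded by `t`. -/
noncomputable def typeSet (tW : W → ℕ) (t : ℕ) : Finset W := {w | digit 2 (tW w) t ≠ 0}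

theorem mem_typeSet {tW : W → ℕ} {t : ℕ} {w : W} : w ∈ typeSet tW t ↔ digit 2 (tW w) t ≠ 0 := by
  simp [typeSet]

theorem edge_ne_zero {R : RankData} {c i j : ℕ} : R.edge c i j ≠ 0 ↔
    0 < R.rw i j ∧ 0 < R.rm i j ∧ R.rw i j ≤ R.gW c i ∧ R.rm i j ≤ R.gM c j := by
  simp only [edge]
  split_ifs <;> omega

namespace Realizes

variable {R : RankData} {tW : W → ℕ} {tM : M → ℕ}

theorem nT_eq (h : R.Realizes tW tM) (t : ℕ) : R.nT t = #(typeSet tW t) := by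
  have e : #(typeSet tW t) = cnt fun w => digit 2 (tW w) t ≠ 0 :=
    le_antisymm (le_cnt fun w => mem_typeSet.1) (cnt_le fun w => mem_typeSet.2)
  rw [e, ← sum_sizes h.tW_lt h.card_w fun i => digit 2 i t ≠ 0, nT]
  exact sum_congr rfl fun i _ => by split_ifs <;> first | rfl | omega

theorem nW_eq (h : R.Realizes tW tM) : R.nW = Fintype.card W := by
  have := sum_sizes h.tW_lt h.card_w fun _ => True
  simpa [cnt, nW] using this

theorem nM_eq (h : R.Realizes tW tM) : R.nM = Fintype.card M := by
  have := sum_sizes h.tM_lt h.card_m fun _ => True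
  simpa [cnt, nM] using this

/-- Since every type is inhabited, a neighbouring type is the same as a neighbouring agent. -/
theorem nbr_ne_zero (h : R.Realizes tW tM) {c t j : ℕ} :
    R.nbr c t j ≠ 0 ↔ ∃ w, digit 2 (tW w) t ≠ 0 ∧ R.edge c (tW w) j ≠ 0 := by
  rw [nbr, ne_eq, sum_eq_zero_iff]
  push Not
  constructor
  · rintro ⟨i, hi, hne⟩
    obtain ⟨w, rfl⟩ := h.exists_w i (mem_range.1 hi)
    split_ifs at hne with h0
    · exact absurd rfl hne
    · exact ⟨w, h0, hne⟩
  · rintro ⟨w, h0, hne⟩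
    exact ⟨tW w, mem_range.2 (h.tW_lt w), by rwa [if_neg h0]⟩

theorem nN_eq (h : R.Realizes tW tM) (c t : ℕ) : R.nN c t =
    cnt fun m => ∃ w ∈ typeSet tW t, R.edge c (tW w) (tM m) ≠ 0 := by
  have := sum_sizes h.tM_lt h.card_m fun j => R.nbr c t j ≠ 0
  simp only [h.nbr_ne_zero] at this
  simp only [mem_typeSet]
  rw [← this, nN]
  refine sum_congr rfl fun j _ => ?_
  simp only [← h.nbr_ne_zero, ne_eq, ite_not]

theorem nB_eq (h : R.Realizes tW tM) (c t : ℕ) : R.nB c t =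
    cnt fun m => (∃ w ∈ typeSet tW t, R.edge c (tW w) (tM m) ≠ 0) ∨
      ¬ R.gM c (tM m) ≤ R.k := by
  have := sum_sizes h.tM_lt h.card_m fun j => R.nbr c t j ≠ 0 ∨ ¬ R.gM c j ≤ R.k
  simp only [h.nbr_ne_zero] at this
  simp only [mem_typeSet]
  rw [← this, nB]
  refine sum_congr rfl fun j _ => ?_
  simp only [← h.nbr_ne_zero]
  split_ifs <;> first | rfl | omega

theorem free_eq_zero (h : R.Realizes tW tM) {c t : ℕ} : R.free c t = 0 ↔
    ∀ w ∈ typeSet tW t, R.gW c (tW w) ≤ R.k := by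
  rw [free, sum_eq_zero_iff]
  simp only [mem_typeSet, mem_range]
  constructor
  · intro H w hw
    have := H _ (h.tW_lt w)
    rw [if_neg hw] at this
    split_ifs at this with h0
    omega
  · intro H i hi
    obtain ⟨w, rfl⟩ := h.exists_w i hi
    split_ifs with h1 h2
    · rfl
    · have := H w h1; omega
    · rfl

theorem unstable_eq_zero (h : R.Realizes tW tM) {c : ℕ} : R.unstable c = 0 ↔
    ∀ w m, 0 < R.rw (tW w) (tM m) → 0 < R.rm (tW w) (tM m) →
      R.gW c (tW w) ≤ R.rw (tW w) (tM m) ∨ R.gM c (tM m) ≤ R.rm (tW w) (tM m) := by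
  simp only [unstable, sum_eq_zero_iff, mem_range]
  constructor
  · intro H w m h1 h2
    have := H _ (h.tW_lt w) _ (h.tM_lt m)
    split_ifs at this <;> omega
  · intro H i hi j hj
    obtain ⟨w, rfl⟩ := h.exists_w i hi
    obtain ⟨m, rfl⟩ := h.exists_m j hj
    have := H w m
    split_ifs <;> omega

/-- A matching with allowed pairs that covers the agents that must be matched, shows that there are
no violations of Hall's condition. -/
theorem le_top_of_covers (h : R.Realizes tW tM) {c : ℕ} {μ : Finset (W × M)}
    (hμ : Covers (fun w m => R.edge c (tW w) (tM m) ≠ 0) (fun w => R.gW c (tW w) ≤ R.k)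
      (fun m => R.gM c (tM m) ≤ R.k) μ) :
    #μ ≤ R.top c ∧ ∀ t, R.hall c t = 0 := by
  have key : ∀ t, HallAt (fun w m => R.edge c (tW w) (tM m) ≠ 0) (fun w => R.gW c (tW w) ≤ R.k)
      (fun m => R.gM c (tM m) ≤ R.k) #μ (typeSet tW t) := fun t => hμ.hallAt _
  have hle : #μ ≤ R.nW := by
    rw [h.nW_eq]
    simpa [cnt] using (hμ.hallAt ∅).all
  have hall : ∀ t, R.nT t + #μ ≤ R.nW + R.nN c t := by
    intro t
    rw [h.nT_eq, h.nW_eq, h.nN_eq]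
    exact (key t).all
  have htop : #μ ≤ R.top c := by
    have : ((range (2 ^ R.k₁)).sup fun t => R.nT t - R.nN c t) ≤ R.nW - #μ :=
      Finset.sup_le fun t _ => by have := hall t; omega
    unfold top
    omega
  refine ⟨htop, fun t => ?_⟩
  have e4 : R.nT t + R.nM ≤ R.nB c t + R.nW := by
    rw [h.nT_eq, h.nW_eq, h.nB_eq, h.nM_eq]
    exact (key t).compl
  unfold RankData.hall
  split_ifs with hf
  · rw [h.free_eq_zero] at hf
    have e1 : R.nT t ≤ R.nN c t := by
      rw [h.nT_eq, h.nN_eq]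
      exact (key t).must hf
    -- This is the only condition tested by `hall` that depends on the size, and it gets weaker as
    -- the size grows; so it passes from `#μ` to `top c`.
    have e3 : R.nT t + R.nM ≤ R.nB c t + #μ := by
      rw [h.nT_eq, h.nB_eq, h.nM_eq]
      exact (key t).must_compl hf
    omega
  · omega

/-- If there are no violations, then Hall's conditions hold. -/
theorem hallAt_top (h : R.Realizes tW tM) {c : ℕ} (hc : R.bad c = 0) (S : Finset W) :
    HallAt (fun w m => R.edge c (tW w) (tM m) ≠ 0) (fun w => R.gW c (tW w) ≤ R.k)
      (fun m => R.gM c (tM m) ≤ R.k) (R.top c) S := by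
  -- `t` codes the types that occur in `S`. The corresponding set of women contains `S`, has the
  -- same neighbours, and lies among the women that must be matched if `S` does.
  obtain ⟨t, ht, hd⟩ := exists_digit 2 R.k₁ (fun i => if ∃ w ∈ S, tW w = i then 1 else 0)
    (fun i _ => by split_ifs <;> omega)
  have mem : ∀ w, digit 2 (tW w) t ≠ 0 ↔ ∃ w' ∈ S, tW w' = tW w := by
    intro w
    rw [hd _ (h.tW_lt w)]
    simp
  have hsub : #S ≤ R.nT t := by
    rw [h.nT_eq]
    refine card_le_card fun w hw => ?_
    simp only [mem_typeSet]
    exact (mem w).2 ⟨w, hw, rfl⟩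
  have hN : ∀ m, (∃ w ∈ typeSet tW t, R.edge c (tW w) (tM m) ≠ 0) ↔
      ∃ w ∈ S, R.edge c (tW w) (tM m) ≠ 0 := by
    intro m
    simp only [mem_typeSet]
    constructor
    · rintro ⟨w, hw, hE⟩
      obtain ⟨w', hw', e⟩ := (mem w).1 hw
      exact ⟨w', hw', by rwa [e]⟩
    · rintro ⟨w, hw, hE⟩
      exact ⟨w, (mem w).2 ⟨w, hw, rfl⟩, hE⟩
  have hA : (∀ w ∈ S, R.gW c (tW w) ≤ R.k) → R.free c t = 0 := by
    intro hA
    rw [h.free_eq_zero]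
    intro w hw
    simp only [mem_typeSet] at hw
    obtain ⟨w', hw', e⟩ := (mem w).1 hw
    rw [← e]
    exact hA w' hw'
  have hnN : R.nN c t = cnt fun m => ∃ w ∈ S, R.edge c (tW w) (tM m) ≠ 0 := by
    rw [h.nN_eq]
    simp only [hN]
  have hnB : R.nB c t =
      cnt fun m => (∃ w ∈ S, R.edge c (tW w) (tM m) ≠ 0) ∨ ¬ R.gM c (tM m) ≤ R.k := by
    rw [h.nB_eq]
    simp only [hN]
  have hall : R.hall c t = 0 := by
    have := (Nat.add_eq_zero_iff.1 hc).2
    exact sum_eq_zero_iff.1 this t (mem_range.2 ht)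
  have htop : R.nT t - R.nN c t ≤ (range (2 ^ R.k₁)).sup fun t => R.nT t - R.nN c t :=
    le_sup (f := fun t => R.nT t - R.nN c t) (mem_range.2 ht)
  -- The greatest deficiency is at most the number of women, so the subtraction in `top` is not
  -- truncated.
  have hle : (range (2 ^ R.k₁)).sup (fun t => R.nT t - R.nN c t) ≤ R.nW := by
    refine Finset.sup_le fun t _ => (Nat.sub_le _ _).trans ?_
    rw [h.nT_eq, h.nW_eq]
    exact card_le_univ _
  unfold RankData.hall at hall
  refine ⟨fun hS => ?_, ?_, fun hS => ?_, ?_⟩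
  · rw [if_pos (hA hS)] at hall
    rw [← hnN]
    omega
  · rw [← hnN, ← h.nW_eq]
    unfold top
    omega
  · rw [if_pos (hA hS)] at hall
    rw [← hnB, ← h.nM_eq]
    omega
  · rw [← hnB, ← h.nM_eq, ← h.nW_eq]
    omega

/-- Thresholds without violations come from stable matchings. -/
theorem exists_stable (h : R.Realizes tW tM) {c : ℕ} (hc : R.bad c = 0) : ∃ μ : Finset (W × M),
    RankStable (fun w m => R.rw (tW w) (tM m)) (fun w m => R.rm (tW w) (tM m)) μ ∧
      #μ = R.top c := by
  obtain ⟨μ, hμ, hcard⟩ := exists_covers (h.hallAt_top hc)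
  refine ⟨μ, ⟨fun p hp => ?_, hμ.inj_fst, hμ.inj_snd, fun w m h1 h2 => ?_⟩, hcard⟩
  · have := edge_ne_zero.1 (hμ.rel p hp)
    exact ⟨this.1, this.2.1⟩
  · rcases h.unstable_eq_zero.1 (Nat.add_eq_zero_iff.1 hc).1 w m h1 h2 with h3 | h3
    -- Ranks are at most `k`, so a threshold below a rank forces the woman to be matched, and her
    -- partner is within the threshold.
    · obtain ⟨m', hm'⟩ := hμ.fst w (h3.trans (h.rw_le _ (h.tW_lt w) _ (h.tM_lt m)))
      exact Or.inl ⟨m', hm', (edge_ne_zero.1 (hμ.rel _ hm')).2.2.1.trans h3⟩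
    · obtain ⟨w', hw'⟩ := hμ.snd m (h3.trans (h.rm_le _ (h.tW_lt w) _ (h.tM_lt m)))
      exact Or.inr ⟨w', hw', (edge_ne_zero.1 (hμ.rel _ hw')).2.2.2.trans h3⟩

/-- Stable matchings have thresholds without violations. -/
theorem exists_code (h : R.Realizes tW tM) {μ : Finset (W × M)}
    (hμ : RankStable (fun w m => R.rw (tW w) (tM m)) (fun w m => R.rm (tW w) (tM m)) μ) :
    ∃ c < (R.k + 2) ^ R.k, R.bad c = 0 ∧ #μ ≤ R.top c := by
  -- The rank of the current partner, or `k + 1` for an unmatched agent. The thresholds `GW` and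
  -- `GM` are the maxima of these values over each type.
  let cw : W → ℕ := fun w => if hw : ∃ m, (w, m) ∈ μ then R.rw (tW w) (tM hw.choose) else R.k + 1
  let cm : M → ℕ := fun m => if hm : ∃ w, (w, m) ∈ μ then R.rm (tW hm.choose) (tM m) else R.k + 1
  have cw_of_mem : ∀ w m, (w, m) ∈ μ → cw w = R.rw (tW w) (tM m) := by
    intro w m hm
    have hw : ∃ m, (w, m) ∈ μ := ⟨m, hm⟩
    have e : (w, hw.choose) = (w, m) := hμ.inj_fst _ hw.choose_spec _ hm rfl
    have e' : hw.choose = m := congrArg Prod.snd e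
    simp only [cw, dif_pos hw, e']
  have cm_of_mem : ∀ w m, (w, m) ∈ μ → cm m = R.rm (tW w) (tM m) := by
    intro w m hm
    have hw : ∃ w, (w, m) ∈ μ := ⟨w, hm⟩
    have e : (hw.choose, m) = (w, m) := hμ.inj_snd _ hw.choose_spec _ hm rfl
    have e' : hw.choose = w := congrArg Prod.fst e
    simp only [cm, dif_pos hw, e']
  have cw_le : ∀ w, cw w ≤ R.k + 1 := by
    intro w
    by_cases hw : ∃ m, (w, m) ∈ μ
    · obtain ⟨m, hm⟩ := hw
      rw [cw_of_mem w m hm]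
      exact (h.rw_le _ (h.tW_lt w) _ (h.tM_lt m)).trans (Nat.le_succ _)
    · simp only [cw, dif_neg hw, le_refl]
  have cm_le : ∀ m, cm m ≤ R.k + 1 := by
    intro m
    by_cases hw : ∃ w, (w, m) ∈ μ
    · obtain ⟨w, hm⟩ := hw
      rw [cm_of_mem w m hm]
      exact (h.rm_le _ (h.tW_lt w) _ (h.tM_lt m)).trans (Nat.le_succ _)
    · simp only [cm, dif_neg hw, le_refl]
  let GW : ℕ → ℕ := fun i => ({w | tW w = i} : Finset W).sup cw
  let GM : ℕ → ℕ := fun j => ({m | tM m = j} : Finset M).sup cm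
  have GW_ge : ∀ w, cw w ≤ GW (tW w) := fun w => le_sup (f := cw) (by simp)
  have GM_ge : ∀ m, cm m ≤ GM (tM m) := fun m => le_sup (f := cm) (by simp)
  have GW_att : ∀ w, ∃ w', tW w' = tW w ∧ GW (tW w) = cw w' := by
    intro w
    obtain ⟨w', hw', e⟩ := exists_mem_eq_sup ({w' | tW w' = tW w} : Finset W) ⟨w, by simp⟩ cw
    exact ⟨w', by simpa using hw', e⟩
  have GM_att : ∀ m, ∃ m', tM m' = tM m ∧ GM (tM m) = cm m' := by
    intro m
    obtain ⟨m', hm', e⟩ := exists_mem_eq_sup ({m' | tM m' = tM m} : Finset M) ⟨m, by simp⟩ cm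
    exact ⟨m', by simpa using hm', e⟩
  have GW_lt : ∀ i, GW i < R.k + 2 := fun i =>
    Nat.lt_succ_of_le (Finset.sup_le fun w _ => cw_le w)
  have GM_lt : ∀ j, GM j < R.k + 2 := fun j =>
    Nat.lt_succ_of_le (Finset.sup_le fun m _ => cm_le m)
  obtain ⟨c, hc, hd⟩ := exists_digit (R.k + 2) R.k
    (fun i => if i < R.k₁ then GW i else GM (i - R.k₁))
    (fun i _ => by split_ifs; exacts [GW_lt _, GM_lt _])
  have gW_eq : ∀ w, R.gW c (tW w) = GW (tW w) := by
    intro w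
    have hw := h.tW_lt w
    rw [gW, hd _ (by unfold k; omega), if_pos hw]
  have gM_eq : ∀ m, R.gM c (tM m) = GM (tM m) := by
    intro m
    have hm := h.tM_lt m
    rw [gM, hd _ (by unfold k; omega), if_neg (by omega), Nat.add_sub_cancel_left]
  have hcov : Covers (fun w m => R.edge c (tW w) (tM m) ≠ 0) (fun w => R.gW c (tW w) ≤ R.k)
      (fun m => R.gM c (tM m) ≤ R.k) μ := by
    refine ⟨fun p hp => ?_, hμ.inj_fst, hμ.inj_snd, fun w hw => ?_, fun m hm => ?_⟩
    · rw [edge_ne_zero, gW_eq, gM_eq, ← cw_of_mem p.1 p.2 hp, ← cm_of_mem p.1 p.2 hp]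
      refine ⟨?_, ?_, GW_ge _, GM_ge _⟩
      · rw [cw_of_mem p.1 p.2 hp]
        exact (hμ.pos p hp).1
      · rw [cm_of_mem p.1 p.2 hp]
        exact (hμ.pos p hp).2
    · by_contra hne
      have := GW_ge w
      rw [gW_eq] at hw
      simp only [cw, dif_neg hne] at this
      omega
    · by_contra hne
      have := GM_ge m
      rw [gM_eq] at hm
      simp only [cm, dif_neg hne] at this
      omega
  obtain ⟨htop, hall⟩ := h.le_top_of_covers hcov
  refine ⟨c, hc, ?_, htop⟩
  rw [bad, sum_eq_zero fun t _ => hall t, add_zero, h.unstable_eq_zero]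
  intro w m h1 h2
  rw [gW_eq, gM_eq]
  obtain ⟨w', hw', ew⟩ := GW_att w
  obtain ⟨m', hm', em⟩ := GM_att m
  rw [ew, em]
  -- The agents are replaced by those of the same types that attain the thresholds; stability of `μ`
  -- at this pair is the required inequality.
  rw [← hw', ← hm'] at h1 h2 ⊢
  rcases hμ.stable w' m' h1 h2 with ⟨m₁, hm₁, hle⟩ | ⟨w₁, hw₁, hle⟩
  · left
    rwa [cw_of_mem _ _ hm₁]
  · right
    rwa [cm_of_mem _ _ hw₁]

/-- The algorithm computes the maximum size of a stable matching. -/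
theorem isGreatest_answer (h : R.Realizes tW tM) : IsGreatest {s : ℕ | ∃ μ : Finset (W × M),
    RankStable (fun w m => R.rw (tW w) (tM m)) (fun w m => R.rm (tW w) (tM m)) μ ∧ #μ = s}
    R.answer := by
  have hub : ∀ μ : Finset (W × M),
      RankStable (fun w m => R.rw (tW w) (tM m)) (fun w m => R.rm (tW w) (tM m)) μ →
      ∃ c ∈ range ((R.k + 2) ^ R.k), R.bad c = 0 ∧ #μ ≤ R.top c ∧ R.top c ≤ R.answer := by
    intro μ hμ
    obtain ⟨c, hc, hbad, hle⟩ := h.exists_code hμ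
    refine ⟨c, mem_range.2 hc, hbad, hle, ?_⟩
    have := le_sup (f := fun c => if R.bad c = 0 then R.top c else 0) (mem_range.2 hc)
    simp only [hbad, if_true] at this
    exact this
  refine ⟨?_, ?_⟩
  · obtain ⟨μ₀, hμ₀⟩ := exists_rankStable (fun (w : W) (m : M) => R.rw (tW w) (tM m))
      (fun w m => R.rm (tW w) (tM m))
    obtain ⟨c₀, hc₀, hbad₀, -, hle₀⟩ := hub μ₀ hμ₀
    obtain ⟨c, hc, e⟩ := exists_mem_eq_sup (range ((R.k + 2) ^ R.k)) ⟨c₀, hc₀⟩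
      (fun c => if R.bad c = 0 then R.top c else 0)
    change R.answer = _ at e
    split_ifs at e with hbad
    · rw [e]
      exact h.exists_stable hbad
    -- If the supremum is attained at a vector with violations, it is `0`; then the valid vector
    -- `c₀`, which comes from an existing stable matching, has value `0` too.
    · have : R.answer = R.top c₀ := by omega
      rw [this]
      exact h.exists_stable hbad₀
  · rintro s ⟨μ, hμ, rfl⟩
    obtain ⟨c, -, -, h1, h2⟩ := hub μ hμ
    exact h1.trans h2

end Realizes

end RankData
/-! ### Ranks in preference lists -/

namespace PrefList

variable {α : Type*} (p : PrefList α)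

theorem rank_pos_iff {b : α} : 0 < p.rank b ↔ p.acceptable b := by
  unfold rank
  split_ifs with h <;> simp [h]

/-- The sets of candidates preferred to a given one are nested along the weak order. If `b` is
preferred to `c`, the inclusion is strict, because `b` is preferred to `c` but not to itself. -/
theorem prefers_iff_rank_lt [Finite α] {b c : α} (hb : p.acceptable b) (hc : p.acceptable c) :
    p.Prefers b c ↔ p.rank b < p.rank c := by
  have mono : ∀ {b c}, p.acceptable b → p.acceptable c → p.weak b c →
      {d | p.Prefers d b} ⊆ {d | p.Prefers d c} := by
    intro b c hb hc hw d hd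
    exact ⟨hd.1, hc, fun h => hd.2.2 (p.weak_trans _ _ _ hb hc hd.1 hw h)⟩
  simp only [rank, hb, hc, if_true, Nat.add_lt_add_iff_right]
  constructor
  · intro h
    have hw : p.weak b c := (p.weak_total b c hb hc).resolve_right h.2.2
    refine Set.ncard_lt_ncard ((Set.ssubset_iff_of_subset (mono hb hc hw)).2 ⟨b, h, fun h' => ?_⟩)
    exact h'.2.2 ((p.weak_total b b hb hb).elim id id)
  · intro h
    refine ⟨hb, hc, fun hw => absurd (Set.ncard_le_ncard (mono hc hb hw)) (not_le.2 h)⟩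

theorem rank_le_card [Finite α] (b : α) : p.rank b ≤ Nat.card α := by
  unfold rank
  split_ifs with h
  · rw [Nat.succ_le_iff, ← Set.ncard_univ]
    refine Set.ncard_lt_ncard ((Set.ssubset_iff_of_subset (Set.subset_univ _)).2
      ⟨b, trivial, fun h' => ?_⟩)
    exact h'.2.2 ((p.weak_total b b h h).elim id id)
  · exact Nat.zero_le _

end PrefList

namespace TypedSMTI

/-! ### Reading the encoding of an instance -/

theorem getD_flatMap {β : Type*} (l : List β) (f : β → List ℕ) (b : ℕ)
    (hf : ∀ x ∈ l, (f x).length = b) (i j : ℕ) (hi : i < l.length) (hj : j < b) (r : List ℕ) :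
    (l.flatMap f ++ r).getD (i * b + j) 0 = (f l[i]).getD j 0 := by
  induction l generalizing i with
  | nil => simp at hi
  | cons x l ih =>
    have hx : (f x).length = b := hf x (by simp)
    rcases i with _ | i
    · rw [List.flatMap_cons, List.append_assoc, List.getD_append _ _ _ _ (by omega)]
      simp
    · rw [List.flatMap_cons, List.append_assoc, List.getD_append_right _ _ _ _ (by
        rw [hx, Nat.succ_mul]; omega)]
      have e : (i + 1) * b + j - (f x).length = i * b + j := by
        rw [hx, Nat.succ_mul]; omega
      rw [e, ih (fun y hy => hf y (by simp [hy])) i (by simpa using hi)]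
      simp

theorem length_flatMap_eq {β : Type*} (l : List β) (f : β → List ℕ) (b : ℕ)
    (hf : ∀ x ∈ l, (f x).length = b) : (l.flatMap f).length = l.length * b := by
  induction l with
  | nil => simp
  | cons x l ih =>
    rw [List.flatMap_cons, List.length_append, hf x (by simp), ih fun y hy => hf y (by simp [hy]),
      List.length_cons, Nat.succ_mul, Nat.add_comm]

variable (D : TypedSMTI)

/-- Right-nested form, in which the blocks are peeled off one after the other; the final `[]` gives
the last table the shape that `getD_flatMap` expects. -/
theorem encode_eq : D.encode = D.k₁ :: D.k₂ :: (List.ofFn D.wSize ++ (List.ofFn D.mSize ++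
    ((List.finRange D.k₁).flatMap (fun i => List.ofFn fun j => (D.wPref i).rank j) ++
    ((List.finRange D.k₂).flatMap (fun j => List.ofFn fun i => (D.mPref j).rank i) ++ [])))) := by
  simp [encode]

/-- The data read from the encoding. -/
noncomputable def data : RankData := RankData.ofInput D.encode

theorem data_k₁ : D.data.k₁ = D.k₁ := by
  simp [data, RankData.ofInput, encode_eq]

theorem data_k₂ : D.data.k₂ = D.k₂ := by
  simp [data, RankData.ofInput, encode_eq]

theorem data_k : D.data.k = D.k := by
  rw [RankData.k, data_k₁, data_k₂, k]

theorem getD_zero : D.encode.getD 0 0 = D.k₁ := by simp [encode_eq]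

theorem getD_one : D.encode.getD 1 0 = D.k₂ := by simp [encode_eq]

theorem data_ws (i : Fin D.k₁) : D.data.ws i = D.wSize i := by
  change D.encode.getD (i + 2) 0 = _
  rw [encode_eq, List.getD_cons_succ, List.getD_cons_succ, List.getD_append _ _ _ _ (by simp)]
  simp

theorem data_ms (j : Fin D.k₂) : D.data.ms j = D.mSize j := by
  change D.encode.getD (j + (2 + D.encode.getD 0 0)) 0 = _
  rw [getD_zero, show j.1 + (2 + D.k₁) = j + D.k₁ + 1 + 1 by omega,
    encode_eq, List.getD_cons_succ, List.getD_cons_succ, List.getD_append_right _ _ _ _ (by simp),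
    List.getD_append _ _ _ _ (by simp)]
  simp

theorem data_rw (i : Fin D.k₁) (j : Fin D.k₂) : D.data.rw i j = (D.wPref i).rank j := by
  change D.encode.getD (i * D.encode.getD 1 0 + j +
    (2 + (D.encode.getD 0 0 + D.encode.getD 1 0))) 0 = _
  rw [getD_zero, getD_one,
    show i.1 * D.k₂ + j.1 + (2 + (D.k₁ + D.k₂)) = i * D.k₂ + j + D.k₂ + D.k₁ + 1 + 1 by omega,
    encode_eq, List.getD_cons_succ, List.getD_cons_succ, List.getD_append_right _ _ _ _ (by simp),
    List.length_ofFn, Nat.add_sub_cancel, List.getD_append_right _ _ _ _ (by simp),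
    List.length_ofFn, Nat.add_sub_cancel,
    getD_flatMap _ _ D.k₂ (by simp) _ _ (by simp) (by simp)]
  simp

theorem data_rm (i : Fin D.k₁) (j : Fin D.k₂) : D.data.rm i j = (D.mPref j).rank i := by
  have hl : ((List.finRange D.k₁).flatMap
      (fun i => List.ofFn fun j => (D.wPref i).rank j)).length = D.k₁ * D.k₂ := by
    rw [length_flatMap_eq _ _ D.k₂ (by simp)]
    simp
  change D.encode.getD (j * D.encode.getD 0 0 + i +
    (2 + (D.encode.getD 0 0 + D.encode.getD 1 0) + D.encode.getD 0 0 * D.encode.getD 1 0)) 0 = _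
  rw [getD_zero, getD_one,
    show j.1 * D.k₁ + i.1 + (2 + (D.k₁ + D.k₂) + D.k₁ * D.k₂) =
      j * D.k₁ + i + D.k₁ * D.k₂ + D.k₂ + D.k₁ + 1 + 1 by omega,
    encode_eq, List.getD_cons_succ, List.getD_cons_succ, List.getD_append_right _ _ _ _ (by simp),
    List.length_ofFn, Nat.add_sub_cancel, List.getD_append_right _ _ _ _ (by simp),
    List.length_ofFn, Nat.add_sub_cancel,
    List.getD_append_right _ _ _ _ (by rw [hl]; omega), hl, Nat.add_sub_cancel,
    getD_flatMap _ _ D.k₁ (by simp) _ _ (by simp) (by simp)]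
  simp

theorem wSize_le (i : Fin D.k₁) : D.wSize i ≤ D.n :=
  (Finset.single_le_sum (f := D.wSize) (fun _ _ => Nat.zero_le _) (Finset.mem_univ i)).trans
    (Nat.le_add_right _ _)

theorem mSize_le (j : Fin D.k₂) : D.mSize j ≤ D.n :=
  (Finset.single_le_sum (f := D.mSize) (fun _ _ => Nat.zero_le _) (Finset.mem_univ j)).trans
    (Nat.le_add_left _ _)

theorem k_le_n : D.k ≤ D.n := by
  unfold k n
  refine Nat.add_le_add ?_ ?_
  · simpa using Finset.card_nsmul_le_sum Finset.univ D.wSize 1 fun i _ => D.wSize_pos i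
  · simpa using Finset.card_nsmul_le_sum Finset.univ D.mSize 1 fun j _ => D.mSize_pos j

theorem rank_w_le (i : Fin D.k₁) (j : Fin D.k₂) : (D.wPref i).rank j ≤ D.k :=
  ((D.wPref i).rank_le_card j).trans (by simp [k])

theorem rank_m_le (i : Fin D.k₁) (j : Fin D.k₂) : (D.mPref j).rank i ≤ D.k :=
  ((D.mPref j).rank_le_card i).trans (by simp [k])

/-- Ranks and numbers of types are at most `k`, and `k ≤ n` because types are non-empty. So every
input entry has at most as many digits as `n`. -/
theorem getD_encode_le (a : ℕ) : D.encode.getD a 0 ≤ D.n := by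
  have hall : ∀ y ∈ D.encode, y ≤ D.n := by
    have hk := D.k_le_n
    intro y hy
    simp only [encode_eq, List.mem_cons, List.mem_append, List.mem_flatMap, List.mem_ofFn,
      List.mem_finRange, true_and, List.not_mem_nil, or_false] at hy
    rcases hy with rfl | rfl | ⟨i, rfl⟩ | ⟨j, rfl⟩ | ⟨i, j, rfl⟩ | ⟨j, i, rfl⟩
    · exact le_trans (Nat.le_add_right _ _) hk
    · exact le_trans (Nat.le_add_left _ _) hk
    · exact D.wSize_le i
    · exact D.mSize_le j
    · exact (D.rank_w_le i j).trans hk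
    · exact (D.rank_m_le i j).trans hk
  rcases lt_or_ge a D.encode.length with h | h
  · rw [List.getD_eq_getElem _ _ h]
    exact hall _ (List.getElem_mem h)
  · rw [List.getD_eq_default _ _ h]
    exact Nat.zero_le _

/-! ### Stable matchings of described instances -/

namespace Describes

variable {D} {W M : Type*} {I : SMTI W M} {tW : W → Fin D.k₁} {tM : M → Fin D.k₂}

/-- `Nat.card` is `0` on infinite types, so fibres of positive cardinality are finite, and there are
finitely many of them. -/
theorem finite_w (h : D.Describes I tW tM) : Finite W := by
  have : ∀ i, Finite {w // tW w = i} := fun i =>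
    Nat.finite_of_card_ne_zero (by rw [h.card_w]; exact (D.wSize_pos i).ne')
  exact Finite.of_equiv _ (Equiv.sigmaFiberEquiv tW)

theorem finite_m (h : D.Describes I tW tM) : Finite M := by
  have : ∀ j, Finite {m // tM m = j} := fun j =>
    Nat.finite_of_card_ne_zero (by rw [h.card_m]; exact (D.mSize_pos j).ne')
  exact Finite.of_equiv _ (Equiv.sigmaFiberEquiv tM)

theorem realizes (h : D.Describes I tW tM) [Fintype W] [Fintype M] :
    D.data.Realizes (fun w => (tW w : ℕ)) (fun m => (tM m : ℕ)) where
  tW_lt w := by rw [data_k₁]; exact (tW w).2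
  tM_lt m := by rw [data_k₂]; exact (tM m).2
  card_w i hi := by
    rw [data_k₁] at hi
    rw [D.data_ws ⟨i, hi⟩, ← h.card_w, Nat.card_eq_fintype_card, Fintype.card_subtype, cnt]
    simp only [Fin.ext_iff]
    congr
  card_m j hj := by
    rw [data_k₂] at hj
    rw [D.data_ms ⟨j, hj⟩, ← h.card_m, Nat.card_eq_fintype_card, Fintype.card_subtype, cnt]
    simp only [Fin.ext_iff]
    congr
  exists_w i hi := by
    rw [data_k₁] at hi
    have h0 : Nat.card {w // tW w = ⟨i, hi⟩} ≠ 0 := by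
      rw [h.card_w]; exact (D.wSize_pos _).ne'
    obtain ⟨⟨w, hw⟩⟩ := (Nat.card_ne_zero.1 h0).1
    exact ⟨w, by rw [hw]⟩
  exists_m j hj := by
    rw [data_k₂] at hj
    have h0 : Nat.card {m // tM m = ⟨j, hj⟩} ≠ 0 := by
      rw [h.card_m]; exact (D.mSize_pos _).ne'
    obtain ⟨⟨m, hm⟩⟩ := (Nat.card_ne_zero.1 h0).1
    exact ⟨m, by rw [hm]⟩
  rw_le i hi j hj := by
    rw [data_k₁] at hi
    rw [data_k₂] at hj
    rw [D.data_rw ⟨i, hi⟩ ⟨j, hj⟩, data_k]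
    exact D.rank_w_le _ _
  rm_le i hi j hj := by
    rw [data_k₁] at hi
    rw [data_k₂] at hj
    rw [D.data_rm ⟨i, hi⟩ ⟨j, hj⟩, data_k]
    exact D.rank_m_le _ _

theorem isStable_iff (h : D.Describes I tW tM) {μ : Finset (W × M)} :
    I.IsStable μ ↔ RankStable (fun w m => D.data.rw (tW w) (tM m))
      (fun w m => D.data.rm (tW w) (tM m)) μ := by
  simp only [data_rw, data_rm]
  have hw : ∀ w m m', (I.wPref w).acceptable m → (I.wPref w).acceptable m' →
      ((I.wPref w).Prefers m m' ↔ (D.wPref (tW w)).rank (tM m) < (D.wPref (tW w)).rank (tM m')) := by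
    intro w m m' h1 h2
    rw [← PrefList.prefers_iff_rank_lt _ ((h.w_acceptable _ _).1 h1) ((h.w_acceptable _ _).1 h2),
      PrefList.Prefers, PrefList.Prefers, h.w_weak w m' m h2 h1, h.w_acceptable, h.w_acceptable]
  have hm : ∀ m w w', (I.mPref m).acceptable w → (I.mPref m).acceptable w' →
      ((I.mPref m).Prefers w w' ↔ (D.mPref (tM m)).rank (tW w) < (D.mPref (tM m)).rank (tW w')) := by
    intro m w w' h1 h2
    rw [← PrefList.prefers_iff_rank_lt _ ((h.m_acceptable _ _).1 h1) ((h.m_acceptable _ _).1 h2),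
      PrefList.Prefers, PrefList.Prefers, h.m_weak m w' w h2 h1, h.m_acceptable, h.m_acceptable]
  constructor
  · rintro ⟨⟨hacc, h1, h2⟩, hst⟩
    refine ⟨fun p hp => ?_, h1, h2, fun w m ha hb => ?_⟩
    · rw [PrefList.rank_pos_iff, PrefList.rank_pos_iff, ← h.w_acceptable, ← h.m_acceptable]
      exact hacc p hp
    · rw [PrefList.rank_pos_iff, ← h.w_acceptable] at ha
      rw [PrefList.rank_pos_iff, ← h.m_acceptable] at hb
      by_contra! hcon
      -- A pair in `μ` would have to be strictly better than itself.
      refine hst w m ⟨fun hmem => absurd (hcon.1 m hmem) (lt_irrefl _), ⟨ha, fun m' hm' => ?_⟩,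
        ⟨hb, fun w' hw' => ?_⟩⟩
      · exact (hw w m m' ha (hacc _ hm').1).2 (hcon.1 m' hm')
      · exact (hm m w w' hb (hacc _ hw').2).2 (hcon.2 w' hw')
  · intro hμ
    refine ⟨⟨fun p hp => ?_, hμ.inj_fst, hμ.inj_snd⟩, ?_⟩
    · have := hμ.pos p hp
      rwa [PrefList.rank_pos_iff, PrefList.rank_pos_iff, ← h.w_acceptable, ← h.m_acceptable]
        at this
    · rintro w m ⟨-, ⟨ha, hpw⟩, hb, hpm⟩
      rcases hμ.stable w m ((PrefList.rank_pos_iff _).2 ((h.w_acceptable _ _).1 ha))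
        ((PrefList.rank_pos_iff _).2 ((h.m_acceptable _ _).1 hb)) with
        ⟨m', hm', hle⟩ | ⟨w', hw', hle⟩
      · have hp := hpw m' hm'
        exact absurd ((hw w m m' ha hp.2.1).1 hp) (not_lt.2 hle)
      · have hp := hpm w' hw'
        exact absurd ((hm m w w' hb hp.2.1).1 hp) (not_lt.2 hle)

theorem isGreatest_answer (h : D.Describes I tW tM) :
    IsGreatest {c : ℕ | ∃ μ : Finset (W × M), I.IsStable μ ∧ μ.card = c} D.data.answer := by
  have := h.finite_w
  have := h.finite_m
  have := Fintype.ofFinite W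
  have := Fintype.ofFinite M
  simp only [h.isStable_iff]
  exact h.realizes.isGreatest_answer

end Describes

end TypedSMTI

/-! ### The running time -/

/-- For `k ≥ 2` one has `k + 4 ≤ k ^ 3` and `k + 2 ≤ k ^ 2`, and a constant `a` is absorbed by `a ≤
2 ^ a ≤ k ^ (a * k)`. The exponent `3 * c + 6` bounds `N`, which occurs twice in the product; `16 +
5 * c` comes from the remaining constants. -/
theorem numberOfSteps_le (c : ℕ) : ∃ C, ∀ k N : ℕ, 2 ≤ k →
    N ≤ (k + 4) ^ c + ((k + 2) ^ k + 2) ^ c + 10 → N * (11 + 5 * c + 5 * N) ≤ k ^ (C * k) := by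
  refine ⟨2 * (3 * c + 6) + (16 + 5 * c), fun k N hk hN => ?_⟩
  have hpow : ∀ {a b : ℕ}, a ≤ b → k ^ a ≤ k ^ b := fun h => Nat.pow_le_pow_right (by omega) h
  have htwo : ∀ a, 2 ^ a ≤ k ^ (a * k) := fun a =>
    (Nat.pow_le_pow_left hk a).trans (hpow (Nat.le_mul_of_pos_right a (by omega)))
  have h1 : k + 4 ≤ k ^ 3 := by
    have : 2 * 2 * k ≤ k * k * k := by gcongr
    calc k + 4 ≤ 2 * 2 * k := by omega
      _ ≤ k * k * k := this
      _ = k ^ 3 := by ring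
  have h2 : k + 2 ≤ k ^ 2 := by nlinarith
  have h3 : (k + 4) ^ c ≤ k ^ (3 * c * k) := by
    refine (Nat.pow_le_pow_left h1 c).trans ?_
    rw [← pow_mul]
    exact hpow (Nat.le_mul_of_pos_right _ (by omega))
  have h4 : (k + 2) ^ k + 2 ≤ k ^ (3 * k) := by
    have e1 : (k + 2) ^ k ≤ k ^ (2 * k) := by
      rw [pow_mul]
      exact Nat.pow_le_pow_left h2 k
    have e2 : 2 ≤ k ^ (2 * k) := hk.trans (by simpa using hpow (show 1 ≤ 2 * k by omega))
    have e3 : 2 ≤ k ^ k := hk.trans (by simpa using hpow (show 1 ≤ k by omega))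
    calc (k + 2) ^ k + 2 ≤ k ^ (2 * k) * 2 := by omega
      _ ≤ k ^ (2 * k) * k ^ k := Nat.mul_le_mul_left _ e3
      _ = k ^ (3 * k) := by rw [← pow_add]; congr 1; omega
  have h5 : ((k + 2) ^ k + 2) ^ c ≤ k ^ (3 * c * k) := by
    refine (Nat.pow_le_pow_left h4 c).trans (le_of_eq ?_)
    rw [← pow_mul]
    congr 1
    ring
  have h6 : N ≤ k ^ ((3 * c + 6) * k) := by
    have e1 : 1 ≤ k ^ (3 * c * k) := Nat.one_le_pow _ _ (by omega)
    have e2 := htwo 6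
    calc N ≤ k ^ (3 * c * k) * 2 ^ 6 := by omega
      _ ≤ k ^ (3 * c * k) * k ^ (6 * k) := Nat.mul_le_mul_left _ e2
      _ = k ^ ((3 * c + 6) * k) := by rw [← pow_add]; congr 1; ring
  have h7 : 11 + 5 * c + 5 * N ≤ k ^ ((16 + 5 * c) * k) * k ^ ((3 * c + 6) * k) := by
    have e1 : 1 ≤ k ^ ((3 * c + 6) * k) := Nat.one_le_pow _ _ (by omega)
    have e2 : 16 + 5 * c ≤ k ^ ((16 + 5 * c) * k) := Nat.lt_two_pow_self.le.trans (htwo _)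
    calc 11 + 5 * c + 5 * N ≤ (16 + 5 * c) * k ^ ((3 * c + 6) * k) := by nlinarith
      _ ≤ _ := Nat.mul_le_mul_right _ e2
  calc N * (11 + 5 * c + 5 * N)
      ≤ k ^ ((3 * c + 6) * k) * (k ^ ((16 + 5 * c) * k) * k ^ ((3 * c + 6) * k)) :=
        Nat.mul_le_mul h6 h7
    _ = k ^ ((2 * (3 * c + 6) + (16 + 5 * c)) * k) := by
        rw [← pow_add, ← pow_add]; congr 1; ring

theorem size_le_logb {n : ℕ} (hn : 2 ≤ n) : (Nat.size n : ℝ) ≤ Real.logb 2 n + 1 := by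
  have h1 : n.size - 1 < n.size := Nat.sub_lt (Nat.size_pos.2 (by omega)) one_pos
  have h2 : 2 ^ (n.size - 1) ≤ n := Nat.lt_size.1 h1
  have h3 : ((n.size - 1 : ℕ) : ℝ) ≤ Real.logb 2 n := by
    rw [Real.le_logb_iff_rpow_le one_lt_two (by positivity), Real.rpow_natCast]
    exact_mod_cast h2
  have h4 : (n.size : ℝ) ≤ ((n.size - 1 : ℕ) : ℝ) + 1 := by
    exact_mod_cast (show n.size ≤ n.size - 1 + 1 by omega)
  linarith

theorem mainTheorem2 :
    ∃ (P : RAM.Program) (C : ℕ), ∀ (D : TypedSMTI), 2 ≤ D.k →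
      ∃ y t : ℕ, RAM.HaltsWith P D.encode y t ∧
        (t : ℝ) ≤ (D.k : ℝ) ^ (C * D.k) * (Real.logb 2 D.n) ^ 2 ∧
        ∀ (W : Type*) (M : Type*) (I : SMTI W M) (tW : W → Fin D.k₁) (tM : M → Fin D.k₂),
          D.Describes I tW tM →
          IsGreatest {c : ℕ | ∃ μ : Finset (W × M), I.IsStable μ ∧ μ.card = c} y := by
  obtain ⟨c, hc⟩ := Expr.program_halts Expr.boundE Expr.answerE
  obtain ⟨C, hC⟩ := numberOfSteps_le c
  refine ⟨Expr.program Expr.boundE Expr.answerE, C, fun D hk => ?_⟩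
  have hn : 2 ≤ D.n := hk.trans D.k_le_n
  have hkk : (RankData.ofInput D.encode).k = D.k := D.data_k
  have hk₁ : (RankData.ofInput D.encode).k₁ = D.k₁ := D.data_k₁
  have hbound : Expr.boundE.eval D.encode (D.k + 2) [] = (D.k + 2) ^ D.k := by
    rw [Expr.eval_boundE [] (by rw [hkk]), hkk]
  have hq : D.k + 2 ≤ (D.k + 2) ^ D.k := Nat.le_self_pow (by omega) _
  have hq₂ : 2 ^ D.k₁ ≤ (D.k + 2) ^ D.k :=
    (Nat.pow_le_pow_left (by omega) _).trans
      (Nat.pow_le_pow_right (by omega) (by unfold TypedSMTI.k; omega))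
  obtain ⟨t, N, hhalt, ht, hN⟩ := hc D.encode D.k _ D.n.size
    (by rw [D.getD_zero, D.getD_one, TypedSMTI.k]) hbound
    fun a => Nat.size_le_size (D.getD_encode_le a)
  rw [Expr.eval_answerE [] (by rwa [hkk]) (by rwa [hk₁]) (by rw [hkk])] at hhalt
  refine ⟨_, t, hhalt, ?_, fun W M I tW tM h => h.isGreatest_answer⟩
  have hL : 1 ≤ Real.logb 2 D.n := by
    rw [Real.le_logb_iff_rpow_le one_lt_two (by positivity), Real.rpow_one]
    exact_mod_cast hn
  have hsize := size_le_logb hn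
  set L := Real.logb 2 D.n
  have hcost : (N * (11 + 5 * c + 5 * N) : ℝ) ≤ (D.k : ℝ) ^ (C * D.k) := by
    exact_mod_cast hC D.k N hk hN
  have ht' : (t : ℝ) ≤ N * (1 + 5 * (c + D.n.size + N)) := by exact_mod_cast ht
  -- The size of `n` is at most `L + 1`; as `L ≥ 1`, everything is absorbed into a multiple of `L`,
  -- with `11 = 1 + 5 + 5`.
  have hin : (1 + 5 * (c + D.n.size + N) : ℝ) ≤ (11 + 5 * c + 5 * N) * L := by
    have h1 : (c : ℝ) ≤ c * L := le_mul_of_one_le_right (Nat.cast_nonneg c) hL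
    have h2 : (N : ℝ) ≤ N * L := le_mul_of_one_le_right (Nat.cast_nonneg N) hL
    linarith
  calc (t : ℝ) ≤ N * (1 + 5 * (c + D.n.size + N)) := ht'
    _ ≤ N * ((11 + 5 * c + 5 * N) * L) := by gcongr
    _ = N * (11 + 5 * c + 5 * N) * L := by ring
    _ ≤ (D.k : ℝ) ^ (C * D.k) * L ^ 2 := by
      -- The cost is already bounded linearly in `L`; the square is obtained from `L ≥ 1`.
      have : L ≤ L ^ 2 := by nlinarith
      gcongr
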